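/- **Proposition 5.6 (subsequential a.s. Clarke stationarity).** For $h:\mathbb R^n\to\mathbb R$ let $h^\circ(x,v)=\limsup_{y\to x,\,t\downarrow 0}\frac{h(y+tv)-h(y)}{t}$ and let $\partial h(x)=\{\zeta\in\mathbb R^n : \zeta^\top v\le h^\circ(x,v)\ \text{for all } v\in\mathbb R^n\}$ be the Clarke subdifferential. For $G:\mathbb R^n\to\mathbb R$, $\eta>0$, $x,z\in\mathbb R^n$ and $v\ge 0$ let $\tilde g_\eta[G](x,v,z)\in\mathbb R^n$ be the vector with components $$\tilde g^{\,i}_\eta[G](x,v,z)=\tfrac{1}{\eta\sqrt{2\pi}}\Big[G\big(x_i+\eta\sqrt{2v},\,x^{-i}-z^{-i}\big)-G\big(x_i-\eta\sqrt{2v},\,x^{-i}-z^{-i}\big)\Big],\qquad i=1,\dots,n,$$ where $u^{-i}=(u_j)_{j\neq i}$. Consider one of the following three settings, in which all functions are jointly measurable and the functions under the integral sign defining $f$ are integrable. 1. *(Decision-independent.)* $f(x)=\mathbb E_{\boldsymbol\xi\sim\nu}[F(x,\boldsymbol\xi)]$, and for some $L_0$, $\|F(x,\cdot)-F(y,\cdot)\|_{L^2(\nu)}\le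 L_0\|x-y\|$ for all $x,y$. Put $G_k(y)=F(y,\boldsymbol\xi_k)$ with $\boldsymbol\xi_k\sim\nu$. 2. *(Decision-dependent, known density.)* $f(x)=\int_{\Xi(x)}\hat F(x,\xi)\,p(\xi\mid x)\,d\xi$, where $p(\cdot\mid x)$ is a probability density (with respect to a fixed $\sigma$-finite measure $d\xi$) that is positive on $\Xi(x)$ and zero outside, and $\tilde p\ge 0$ is a probability density that is positive on every $\Xi(x)$. There are constants $L_\xi,M,\hat L_f,M_f$ such that for all $x,y$: $D_{\mathrm{KL}}(p(\cdot\mid x)\|p(\cdot\mid y))+D_{\mathrm{KL}}(p(\cdot\mid y)\|p(\cdot\mid x))\le L_\xi^2\|x-y\|^2$; $p(\xi\mid x)/\tilde p(\xi)\le M$ for $\xi\in\Xi(x)$; $\|\hat F(x,\cdot)-\hat F(y,\cdot)\|_{L^2(\tilde p)}\le \hat L_f\|x-y\|$; and $|\hat F(x,\xi)|\le M_f$ for almost every $\xi\in\Xi(x)$. Put $G_k(y)=\hat F(y,\boldsymbol\xi_k)\,p(\boldsymbol\xi_k\mid y)/\tilde p(\boldsymbol\xi_k)$ with $\boldsymbol\xi_k\sim\tilde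 p$. 3. *(Decision-dependent, unknown density.)* $f(x)=\mathbb E_{\boldsymbol\xi\sim\mathcal D(x)}[\hat F(x,\boldsymbol\xi)]$, and there is a measurable random field $(\boldsymbol\xi_x)_{x\in\mathbb R^n}$ with $\boldsymbol\xi_x\sim\mathcal D(x)$ such that for some $L_0$, $\|\hat F(x,\boldsymbol\xi_x)-\hat F(y,\boldsymbol\xi_y)\|_{L^2}\le L_0\|x-y\|$ for all $x,y$. Put $G_k(y)=\hat F(y,\boldsymbol\xi_{k,y})$, where $\boldsymbol\xi_k=(\boldsymbol\xi_{k,y})_{y}$ is a copy of the field. Let $(\gamma_k)_{k\ge0}$ and $(\eta_k)_{k\ge0}$ be positive with $\eta_k\to0$, $\sum_{k\ge1}|\eta_k-\eta_{k-1}|<\infty$, $\sum_{k\ge0}\gamma_k^2/\eta_k<\infty$ and $\sum_{k\ge0}\gamma_k=\infty$. Let $V_k\sim\mathrm{Exp}(1)$, $Z_k\sim\mathcal N(0,\eta_k^2 I_n)$ and $\boldsymbol\xi_k$ $(k\ge0)$ be mutually independent, let $x_0\in\mathbb R^n$ be given and $$x_{k+1}=x_k-\gamma_k\,\tilde g_{\eta_k}[G_k](x_k,V_k,Z_k),\qquad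 k\ge 0 .$$ Suppose that every subsequence of $(x_k)$ has an almost surely convergent subsubsequence (the index sequences being deterministic). Then there is a cluster point $x^*$ of $(x_k)$, that is, a random vector $x^*$ that is the almost sure limit of some subsequence $(x_{m_j})_j$ with deterministic indices, such that $0\in\partial f(x^*)$ almost surely. -/

import Mathlib

open MeasureTheory ProbabilityTheory Filter Topology
open scoped NNReal ENNReal

noncomputable section

/-- The decision space `ℝⁿ` with its Euclidean norm. -/
abbrev Rn (n : ℕ) : Type := EuclideanSpace ℝ (Fin n)

/-! ### Clarke calculus -/

/-- Clarke's generalized directional derivative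
`h°(x, v) = limsup_{y → x, t ↓ 0} (h (y + t v) - h y) / t`, as an extended real number
(for locally Lipschitz `h` it is finite). -/
def clarkeDeriv {n : ℕ} (h : Rn n → ℝ) (x v : Rn n) : EReal :=
  limsup (fun q : Rn n × ℝ => (((h (q.1 + q.2 • v) - h q.1) / q.2 : ℝ) : EReal))
    (𝓝 x ×ˢ 𝓝[>] (0 : ℝ))

/-- The Clarke subdifferential `∂h(x) = {ζ | ζᵀ v ≤ h°(x, v) for all v}`. -/
def clarkeSubdifferential {n : ℕ} (h : Rn n → ℝ) (x : Rn n) : Set (Rn n) :=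
  {ζ | ∀ v : Rn n, ((inner ℝ ζ v : ℝ) : EReal) ≤ clarkeDeriv h x v}

/-! ### The exponentially shifted Gaussian smoothing estimator -/

/-- The point `(x_i + s, x^{-i} - z^{-i})`: coordinate `i` of `x` is shifted by `s`, every other
coordinate `j` becomes `x_j - z_j`. -/
def shiftedPoint {n : ℕ} (x z : Rn n) (i : Fin n) (s : ℝ) : Rn n :=
  WithLp.toLp 2 (Function.update (fun j => x j - z j) i (x i + s))

/-- The estimator built from evaluations of a (sampled) function `G`: its `i`-th component is
`(G (x_i + η √(2v), x^{-i} - z^{-i}) - G (x_i - η √(2v), x^{-i} - z^{-i})) / (η √(2π))`. -/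
def esGs {n : ℕ} (η : ℝ) (G : Rn n → ℝ) (x : Rn n) (v : ℝ) (z : Rn n) : Rn n :=
  WithLp.toLp 2 fun i =>
    1 / (η * Real.sqrt (2 * Real.pi)) *
      (G (shiftedPoint x z i (η * Real.sqrt (2 * v)))
        - G (shiftedPoint x z i (-(η * Real.sqrt (2 * v)))))

/-- The random inputs of the method: at iteration `k`, `V_k ∼ Exp(1)`, `Z_k ∼ N(0, η_k² I)` and the
sample `ξ_k ∼ ν` are independent, and the triples `(V_k, Z_k, ξ_k)` are independent over `k`. -/
structure IsSampling {n : ℕ} {Ω S : Type*} [MeasurableSpace Ω] [MeasurableSpace S]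
    (P : Measure Ω) (η : ℕ → ℝ) (ν : Measure S)
    (V : ℕ → Ω → ℝ) (Z : ℕ → Ω → Rn n) (ξ : ℕ → Ω → S) : Prop where
  measurable_V : ∀ k, Measurable (V k)
  measurable_Z : ∀ k, Measurable (Z k)
  measurable_ξ : ∀ k, Measurable (ξ k)
  hasLaw : ∀ k, HasLaw (fun ω => (V k ω, Z k ω, ξ k ω))
    ((expMeasure 1).prod
      ((multivariateGaussian (0 : Rn n) ((η k) ^ 2 • (1 : Matrix (Fin n) (Fin n) ℝ))).prod ν)) P
  indep : iIndepFun (fun k ω => (V k ω, Z k ω, ξ k ω)) P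

/-- The iteration `x_{k+1} = x_k - γ_k g_k` started at the deterministic point `x₀`, where `g_k` is
the estimator with smoothing parameter `η_k` built from the function `G k ω` sampled at
iteration `k`. -/
structure IsIteration {n : ℕ} {Ω : Type*} (x₀ : Rn n) (γ η : ℕ → ℝ)
    (G : ℕ → Ω → Rn n → ℝ) (V : ℕ → Ω → ℝ) (Z : ℕ → Ω → Rn n) (x : ℕ → Ω → Rn n) : Prop where
  init : ∀ ω, x 0 ω = x₀
  step : ∀ k ω, x (k + 1) ω = x k ω - γ k • esGs (η k) (G k ω) (x k ω) (V k ω) (Z k ω)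

/-- The requirements on the step sizes `γ` and the smoothing parameters `η`. -/
structure IsStepChoice (γ η : ℕ → ℝ) : Prop where
  γ_pos : ∀ k, 0 < γ k
  η_pos : ∀ k, 0 < η k
  η_tendsto : Tendsto η atTop (𝓝 0)
  summable_diff : Summable fun k => |η (k + 1) - η k|
  summable_sq_div : Summable fun k => γ k ^ 2 / η k
  sum_γ : Tendsto (fun K => ∑ k ∈ Finset.range K, γ k) atTop atTop

/-! ### The three models of the objective -/

/-- Decision-independent model, `f x = E_ν[F(x, ξ)]`: `F(·, ξ)` is `L₀`-Lipschitz in the `L²(ν)`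
norm. -/
structure StandardModel {n : ℕ} {S : Type*} [MeasurableSpace S]
    (ν : Measure S) (F : Rn n → S → ℝ) (L₀ : ℝ≥0) : Prop where
  isProbability : IsProbabilityMeasure ν
  measurable : Measurable fun q : Rn n × S => F q.1 q.2
  integrable : ∀ x, Integrable (F x) ν
  lipschitz : ∀ x y,
    eLpNorm (fun s => F x s - F y s) 2 ν ≤ ENNReal.ofReal ((L₀ : ℝ) * ‖x - y‖)

/-- The measure with density `p` with respect to the reference measure `lam`. -/
def densityMeasure {S : Type*} [MeasurableSpace S] (lam : Measure S) (p : S → ℝ) : Measure S :=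
  lam.withDensity fun s => ENNReal.ofReal (p s)

/-- Decision-dependent model with known densities: `p x` is the density of `D(x)` with respect to
`lam`, carried by `supp x` (the set `Ξ(x)`), and `pt` is the sampling density chosen by the user.
The symmetric Kullback-Leibler divergence of `D(x)` and `D(y)` is at most `Lξ² ‖x - y‖²`, the ratio
`p x / pt` is at most `M` on `Ξ(x)`, and `F` is `Lf`-Lipschitz in the `L²(pt)` norm and bounded
by `Mf`. -/
structure KnownDensityModel {n : ℕ} {S : Type*} [MeasurableSpace S]
    (lam : Measure S) (supp : Rn n → Set S) (p : Rn n → S → ℝ) (pt : S → ℝ)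
    (F : Rn n → S → ℝ) (Lξ M Lf Mf : ℝ≥0) : Prop where
  sigmaFinite : SigmaFinite lam
  measurable_F : Measurable fun q : Rn n × S => F q.1 q.2
  measurable_p : Measurable fun q : Rn n × S => p q.1 q.2
  measurable_pt : Measurable pt
  pt_nonneg : ∀ s, 0 ≤ pt s
  pt_pos : ∀ x, ∀ s ∈ supp x, 0 < pt s
  pt_probability : IsProbabilityMeasure (densityMeasure lam pt)
  p_pos : ∀ x, ∀ s ∈ supp x, 0 < p x s
  p_zero : ∀ x, ∀ s ∉ supp x, p x s = 0
  p_probability : ∀ x, IsProbabilityMeasure (densityMeasure lam (p x))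
  symm_kl_le : ∀ x y,
    InformationTheory.klDiv (densityMeasure lam (p x)) (densityMeasure lam (p y))
      + InformationTheory.klDiv (densityMeasure lam (p y)) (densityMeasure lam (p x))
      ≤ ENNReal.ofReal ((Lξ : ℝ) ^ 2 * ‖x - y‖ ^ 2)
  ratio_le : ∀ x, ∀ s ∈ supp x, p x s / pt s ≤ M
  lipschitz : ∀ x y, eLpNorm (fun s => F x s - F y s) 2 (densityMeasure lam pt)
      ≤ ENNReal.ofReal ((Lf : ℝ) * ‖x - y‖)
  bounded : ∀ x, ∀ᵐ s ∂lam, s ∈ supp x → |F x s| ≤ Mf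

/-- Decision-dependent model with unknown densities: `field` is a measurable random field
`(ξ_x)_x` on the probability space `(S, ν)` with values in `E` and marginals `ξ_x ∼ D x`, and
`F(·, ξ_·)` is `L₀`-Lipschitz in the `L²` norm. -/
structure RandomFieldModel {n : ℕ} {S E : Type*} [MeasurableSpace S] [MeasurableSpace E]
    (ν : Measure S) (field : Rn n → S → E) (D : Rn n → Measure E)
    (F : Rn n → E → ℝ) (L₀ : ℝ≥0) : Prop where
  isProbability : IsProbabilityMeasure ν
  measurable_field : Measurable fun q : Rn n × S => field q.1 q.2
  measurable_F : Measurable fun q : Rn n × E => F q.1 q.2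
  marginal : ∀ x, HasLaw (field x) (D x) ν
  integrable : ∀ x, Integrable (F x) (D x)
  lipschitz : ∀ x y, eLpNorm (fun s => F x (field x s) - F y (field y s)) 2 ν
      ≤ ENNReal.ofReal ((L₀ : ℝ) * ‖x - y‖)

/-! ### Subsequential convergence -/

/-- Every subsequence of `x` has an almost surely convergent subsubsequence (the index sequences
are deterministic, the limit may be random). -/
def HasASConvergentSubsubsequences {n : ℕ} {Ω : Type*} [MeasurableSpace Ω] (P : Measure Ω)
    (x : ℕ → Ω → Rn n) : Prop :=
  ∀ a : ℕ → ℕ, StrictMono a → ∃ b : ℕ → ℕ, StrictMono b ∧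
    ∀ᵐ ω ∂P, ∃ l : Rn n, Tendsto (fun j => x (a (b j)) ω) atTop (𝓝 l)

/-- Some cluster point of `x`, that is, the almost sure limit `xs` of some subsequence, is almost
surely a Clarke stationary point of `f`. -/
def HasStationaryClusterPoint {n : ℕ} {Ω : Type*} [MeasurableSpace Ω] (P : Measure Ω)
    (x : ℕ → Ω → Rn n) (f : Rn n → ℝ) : Prop :=
  ∃ xs : Ω → Rn n, Measurable xs ∧
    (∃ m : ℕ → ℕ, StrictMono m ∧ ∀ᵐ ω ∂P, Tendsto (fun j => x (m j) ω) atTop (𝓝 (xs ω))) ∧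
    ∀ᵐ ω ∂P, (0 : Rn n) ∈ clarkeSubdifferential f (xs ω)

end

noncomputable section

/-! ### The exponential distribution -/

/-! The estimator is an unbiased gradient of the Gaussian smoothing `f_η`, and the method is
stochastic gradient descent on the slowly varying potentials `f_{η_k}`. For `V ∼ Exp(1)` and `R =
η√(2V)`, the density of `N(0, η²)` at `u` is `P(|u| < R) / (η√(2π))`, so a Gaussian integral of `h`
is the mean of `∫_{-R}^{R} h / (η√(2π))`. Shifting `h` changes this to first order by `h(R) -
h(-R)`, without differentiating `h`. Coordinate by coordinate this gives a quadratic expansion of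
`f_η` with constant `O(L/η)` (`abs_smoothing_add_sub_inner_le`), while the second moment of the
estimator stays bounded uniformly in `η` (`StandardModel.lintegral_esGs_sq_le`).

Summing the descent inequality bounds `∑ γ_k ‖∇f_{η_k}(x_k)‖²` by the drop of the potential, an
`L²`-bounded martingale, and errors controlled by `∑ γ_k²/η_k` and `∑ |η_{k+1} - η_k|`. No
martingale convergence theorem is needed. Fatou's lemma along one almost surely convergent
subsequence keeps the error terms bounded infinitely often, and the iterates are pathwise bounded
there, so the sum is almost surely finite (`IsNoisyDescent.ae_tsum_ne_top`).

As `∑ γ_k = ∞`, the gradients tend to `0` almost surely along deterministic indices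
(`exists_strictMono_ae_tendsto_zero`). A further almost surely convergent subsequence has a Clarke
stationary limit (`zero_mem_clarkeSubdifferential`).

All three settings reduce to a random function that is Lipschitz in `L²`. Only the known-density
case needs work: the symmetric KL bound controls the weights through `sq_sub_le_max_mul_klFun`. -/

instance isProbabilityMeasure_expMeasure_one : IsProbabilityMeasure (expMeasure 1) :=
  isProbabilityMeasure_expMeasure one_pos

lemma expMeasure_one_Ioi {t : ℝ} (ht : 0 ≤ t) :
    expMeasure 1 (Set.Ioi t) = ENNReal.ofReal (Real.exp (-t)) := by
  have h := cdf_expMeasure_eq one_pos t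
  rw [cdf_eq_real, if_pos ht, one_mul] at h
  have h2 := prob_compl_eq_one_sub (μ := expMeasure 1) (measurableSet_Iic (a := t))
  rw [Set.compl_Iic] at h2
  rw [h2, ← ofReal_measureReal (μ := expMeasure 1) (s := Set.Iic t), h, ← ENNReal.ofReal_one,
    ← ENNReal.ofReal_sub _ (by simpa using ht)]
  congr 1
  ring

lemma lintegral_ofReal_expMeasure_one_lt_top :
    ∫⁻ v, ENNReal.ofReal v ∂expMeasure 1 < ∞ := by
  have h : ∫⁻ v, ENNReal.ofReal v ∂expMeasure 1
      = ∫⁻ v, ENNReal.ofReal (max v 0) ∂expMeasure 1 := by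
    refine lintegral_congr fun v => ?_
    rcases le_total v 0 with hv | hv <;> simp [hv]
  rw [h, lintegral_eq_lintegral_meas_lt (f := fun v : ℝ => max v 0) _
    (ae_of_all _ fun v => le_max_right _ _) (by fun_prop)]
  have h2 : ∫⁻ t in Set.Ioi (0 : ℝ), expMeasure 1 {v | t < max v 0}
      = ∫⁻ t in Set.Ioi (0 : ℝ), ENNReal.ofReal (Real.exp (-t)) := by
    refine setLIntegral_congr_fun measurableSet_Ioi fun t ht => ?_
    replace ht : 0 < t := ht
    have : {v : ℝ | t < max v 0} = Set.Ioi t := by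
      ext v
      simp [not_lt.2 ht.le]
    simp only [this, expMeasure_one_Ioi ht.le]
  rw [h2]
  exact (integrableOn_exp_neg_Ioi 0).lintegral_lt_top

/-- The random half-width `η √(2v)` of the estimator. -/
def halfWidth (η v : ℝ) : ℝ := η * Real.sqrt (2 * v)

@[fun_prop]
lemma measurable_halfWidth (η : ℝ) : Measurable (halfWidth η) := by
  unfold halfWidth
  fun_prop

lemma halfWidth_nonneg {η : ℝ} (hη : 0 ≤ η) (v : ℝ) : 0 ≤ halfWidth η v :=
  mul_nonneg hη (Real.sqrt_nonneg _)

/-- For negative `v` both `Real.sqrt` and `ENNReal.ofReal` truncate to `0`, so no restriction to the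
support of the exponential law is needed. -/
lemma ofReal_halfWidth_sq (η v : ℝ) :
    ENNReal.ofReal (halfWidth η v ^ 2) = ENNReal.ofReal (2 * η ^ 2) * ENNReal.ofReal v := by
  rw [← ENNReal.ofReal_mul (by positivity), halfWidth, mul_pow]
  rcases le_total 0 v with hv | hv
  · rw [Real.sq_sqrt (by positivity)]
    congr 1
    ring
  · rw [Real.sqrt_eq_zero_of_nonpos (by linarith), ENNReal.ofReal_of_nonpos (p := 2 * η ^ 2 * v)]
    · simp
    · exact mul_nonpos_of_nonneg_of_nonpos (by positivity) hv

lemma lintegral_halfWidth_sq (η : ℝ) :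
    ∫⁻ v, ENNReal.ofReal (halfWidth η v ^ 2) ∂expMeasure 1
      = ENNReal.ofReal (2 * η ^ 2) * ∫⁻ v, ENNReal.ofReal v ∂expMeasure 1 := by
  simp_rw [ofReal_halfWidth_sq]
  rw [lintegral_const_mul _ (by fun_prop)]

lemma memLp_halfWidth (η : ℝ) : MemLp (halfWidth η) 2 (expMeasure 1) := by
  rw [memLp_two_iff_integrable_sq (by fun_prop)]
  refine ⟨by fun_prop, ?_⟩
  rw [hasFiniteIntegral_iff_ofReal (ae_of_all _ fun v => sq_nonneg _), lintegral_halfWidth_sq]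
  exact ENNReal.mul_lt_top ENNReal.ofReal_lt_top lintegral_ofReal_expMeasure_one_lt_top

lemma integrable_halfWidth (η : ℝ) : Integrable (halfWidth η) (expMeasure 1) :=
  (memLp_halfWidth η).integrable one_le_two

/-! ### The Gaussian distribution as a mixture of uniform distributions -/

/-- The centred real Gaussian distribution with standard deviation `η`. -/
def centredGaussian (η : ℝ) : Measure ℝ := gaussianReal 0 (η ^ 2).toNNReal

instance (η : ℝ) : IsProbabilityMeasure (centredGaussian η) := by
  unfold centredGaussian
  infer_instance

instance (η : ℝ) : IsGaussian (centredGaussian η) := by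
  unfold centredGaussian
  infer_instance

/-- The event is `v > u² / (2η²)`, so the exponential tail is exactly the Gaussian exponent. -/
lemma expMeasure_lt_halfWidth {η : ℝ} (hη : 0 < η) (u : ℝ) :
    expMeasure 1 {v | |u| < halfWidth η v} = ENNReal.ofReal (Real.exp (-(u ^ 2 / (2 * η ^ 2)))) := by
  rw [← expMeasure_one_Ioi (by positivity)]
  congr 1
  ext v
  rw [Set.mem_ofPred_eq, Set.mem_Ioi, halfWidth, mul_comm, ← div_lt_iff₀ hη,
    Real.lt_sqrt (by positivity), div_pow, sq_abs, div_lt_iff₀ (by positivity),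
    div_lt_iff₀ (by positivity)]
  constructor <;> intro h <;> linarith

lemma gaussianPDFReal_eq_expMeasure {η : ℝ} (hη : 0 < η) (u : ℝ) :
    gaussianPDFReal 0 (η ^ 2).toNNReal u
      = 1 / (η * Real.sqrt (2 * Real.pi)) * (expMeasure 1).real {v | |u| < halfWidth η v} := by
  rw [measureReal_def, expMeasure_lt_halfWidth hη, ENNReal.toReal_ofReal (Real.exp_pos _).le,
    gaussianPDFReal]
  rw [Real.coe_toNNReal _ (sq_nonneg η), sub_zero]
  rw [Real.sqrt_mul (by positivity), Real.sqrt_sq hη.le, neg_div, one_div, mul_comm η]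

lemma measurableSet_lt_halfWidth (η : ℝ) :
    MeasurableSet {q : ℝ × ℝ | |q.2| < halfWidth η q.1} :=
  measurableSet_lt (by fun_prop) (by fun_prop)

/-- This justifies Fubini in the mixture formula: integrating the norm over `v` leaves the Gaussian
density times `|h u|`. -/
lemma integrable_mixture {η : ℝ} (hη : 0 < η) {h : ℝ → ℝ} (hm : Measurable h)
    (hh : Integrable h (centredGaussian η)) :
    Integrable ({q : ℝ × ℝ | |q.2| < halfWidth η q.1}.indicator
      fun q => 1 / (η * Real.sqrt (2 * Real.pi)) * h q.2) ((expMeasure 1).prod volume) := by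
  have hv : (η ^ 2).toNNReal ≠ 0 := by
    simpa using hη.ne'
  have hmeas : Measurable ({q : ℝ × ℝ | |q.2| < halfWidth η q.1}.indicator
      fun q => 1 / (η * Real.sqrt (2 * Real.pi)) * h q.2) :=
    Measurable.indicator (by fun_prop) (measurableSet_lt_halfWidth η)
  rw [integrable_prod_iff' hmeas.aestronglyMeasurable]
  refine ⟨ae_of_all _ fun u => ?_, ?_⟩
  · have : (fun v => {q : ℝ × ℝ | |q.2| < halfWidth η q.1}.indicator
        (fun q => 1 / (η * Real.sqrt (2 * Real.pi)) * h q.2) (v, u))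
        = {v | |u| < halfWidth η v}.indicator
          fun _ => 1 / (η * Real.sqrt (2 * Real.pi)) * h u := by
      ext v
      simp [Set.indicator]
    rw [this]
    exact (integrable_const _).indicator (measurableSet_lt (by fun_prop) (by fun_prop))
  · have : (fun u => ∫ v, ‖{q : ℝ × ℝ | |q.2| < halfWidth η q.1}.indicator
        (fun q => 1 / (η * Real.sqrt (2 * Real.pi)) * h q.2) (v, u)‖ ∂expMeasure 1)
        = fun u => gaussianPDFReal 0 (η ^ 2).toNNReal u * ‖h u‖ := by
      ext u
      have : (fun v => ‖{q : ℝ × ℝ | |q.2| < halfWidth η q.1}.indicator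
        (fun q => 1 / (η * Real.sqrt (2 * Real.pi)) * h q.2) (v, u)‖)
        = {v | |u| < halfWidth η v}.indicator
          fun _ => 1 / (η * Real.sqrt (2 * Real.pi)) * ‖h u‖ := by
        ext v
        rw [norm_indicator_eq_indicator_norm]
        simp only [norm_mul, Real.norm_of_nonneg
          (show 0 ≤ 1 / (η * Real.sqrt (2 * Real.pi)) by positivity)]
        simp [Set.indicator]
      rw [this, integral_indicator (measurableSet_lt (by fun_prop) (by fun_prop)),
        setIntegral_const, gaussianPDFReal_eq_expMeasure hη, smul_eq_mul]
      ring
    rw [this]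
    have h2 := hh.norm
    rw [centredGaussian, gaussianReal_of_var_ne_zero _ hv,
      integrable_withDensity_iff_integrable_smul₀' (measurable_gaussianPDF _ _).aemeasurable
        (ae_of_all _ fun _ => gaussianPDF_lt_top)] at h2
    simpa [toReal_gaussianPDF] using h2

lemma integral_mixture_fst {η : ℝ} (hη : 0 ≤ η) (h : ℝ → ℝ) (v : ℝ) :
    ∫ u, {q : ℝ × ℝ | |q.2| < halfWidth η q.1}.indicator
      (fun q => 1 / (η * Real.sqrt (2 * Real.pi)) * h q.2) (v, u)
      = 1 / (η * Real.sqrt (2 * Real.pi)) * ∫ u in -halfWidth η v..halfWidth η v, h u := by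
  have : (fun u => {q : ℝ × ℝ | |q.2| < halfWidth η q.1}.indicator
        (fun q => 1 / (η * Real.sqrt (2 * Real.pi)) * h q.2) (v, u))
        = (Set.Ioo (-halfWidth η v) (halfWidth η v)).indicator
          fun u => 1 / (η * Real.sqrt (2 * Real.pi)) * h u := by
    ext u
    simp [Set.indicator, abs_lt]
  rw [this, integral_indicator measurableSet_Ioo, integral_const_mul,
    intervalIntegral.integral_of_le (by linarith [halfWidth_nonneg hη v]),
    integral_Ioc_eq_integral_Ioo]

lemma integrable_integral_halfWidth {η : ℝ} (hη : 0 < η) {h : ℝ → ℝ} (hm : Measurable h)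
    (hh : Integrable h (centredGaussian η)) :
    Integrable (fun v => 1 / (η * Real.sqrt (2 * Real.pi)) *
      ∫ u in -halfWidth η v..halfWidth η v, h u) (expMeasure 1) := by
  have := (integrable_mixture hη hm hh).integral_prod_left
  simpa only [integral_mixture_fst hη.le] using this

/-- A centred Gaussian variable is uniformly distributed on the random interval
`[-η √(2V), η √(2V)]` weighted by its length, where `V ∼ Exp(1)`. -/
lemma integral_centredGaussian {η : ℝ} (hη : 0 < η) {h : ℝ → ℝ} (hm : Measurable h)
    (hh : Integrable h (centredGaussian η)) :
    ∫ u, h u ∂centredGaussian η = ∫ v, 1 / (η * Real.sqrt (2 * Real.pi)) *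
      (∫ u in -halfWidth η v..halfWidth η v, h u) ∂expMeasure 1 := by
  have hv : (η ^ 2).toNNReal ≠ 0 := by
    simpa using hη.ne'
  simp_rw [← integral_mixture_fst hη.le]
  rw [integral_integral_swap (f := fun v u => {q : ℝ × ℝ | |q.2| < halfWidth η q.1}.indicator
        (fun q => 1 / (η * Real.sqrt (2 * Real.pi)) * h q.2) (v, u)) (integrable_mixture hη hm hh),
    centredGaussian, integral_gaussianReal_eq_integral_smul hv]
  refine integral_congr_ae (ae_of_all _ fun u => ?_)
  have : (fun v => {q : ℝ × ℝ | |q.2| < halfWidth η q.1}.indicator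
        (fun q => 1 / (η * Real.sqrt (2 * Real.pi)) * h q.2) (v, u))
        = {v | |u| < halfWidth η v}.indicator
          fun _ => 1 / (η * Real.sqrt (2 * Real.pi)) * h u := by
      ext v
      simp [Set.indicator]
  simp only [this]
  rw [integral_indicator (measurableSet_lt (by fun_prop) (by fun_prop)),
        setIntegral_const, gaussianPDFReal_eq_expMeasure hη, smul_eq_mul, smul_eq_mul]
  ring

/-! ### First order expansion of the Gaussian smoothing on the line -/

lemma abs_intervalIntegral_sub_mul_le {L : ℝ≥0} {h : ℝ → ℝ} (hL : LipschitzWith L h) (r a : ℝ) :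
    |(∫ u in r..r + a, h u) - a * h r| ≤ L * a ^ 2 := by
  have h1 : (∫ u in r..r + a, h u) - a * h r = ∫ u in r..r + a, (h u - h r) := by
    rw [intervalIntegral.integral_sub (hL.continuous.intervalIntegrable _ _) (by simp)]
    simp
  rw [h1]
  have := intervalIntegral.norm_integral_le_of_norm_le_const (a := r) (b := r + a)
    (f := fun u => h u - h r) (C := L * |a|) fun u hu => ?_
  · simpa [mul_assoc, ← sq] using this
  · refine (hL.norm_sub_le u r).trans ?_
    gcongr
    rcases le_total 0 a with ha | ha
    · rw [Set.uIoc_of_le (by linarith), Set.mem_Ioc] at hu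
      rw [Real.norm_eq_abs, abs_of_nonneg (by linarith), abs_of_nonneg ha]
      linarith
    · rw [Set.uIoc_of_ge (by linarith), Set.mem_Ioc] at hu
      rw [Real.norm_eq_abs, abs_of_nonpos (by linarith), abs_of_nonpos ha]
      linarith

/-- Translating the window changes the integral only at its two ends, and each end contributes `a`
times the endpoint value up to `L a²`. The error does not depend on `r`, so it survives averaging
over a random half-width. -/
lemma abs_integral_symm_shift_le {L : ℝ≥0} {h : ℝ → ℝ} (hL : LipschitzWith L h) (r a : ℝ) :
    |(∫ u in -r..r, h (a + u)) - (∫ u in -r..r, h u) - a * (h r - h (-r))| ≤ 2 * L * a ^ 2 := by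
  have hi : ∀ s t, IntervalIntegrable h volume s t := hL.continuous.intervalIntegrable
  rw [intervalIntegral.integral_comp_add_left, add_comm a (-r), add_comm a r]
  have e1 := intervalIntegral.integral_add_adjacent_intervals (hi (-r) r) (hi r (r + a))
  have e2 := intervalIntegral.integral_add_adjacent_intervals (hi (-r) (-r + a)) (hi (-r + a) (r + a))
  have h1 := abs_le.1 (abs_intervalIntegral_sub_mul_le hL r a)
  have h2 := abs_le.1 (abs_intervalIntegral_sub_mul_le hL (-r) a)
  rw [abs_le]
  constructor <;> linarith [h1.1, h1.2, h2.1, h2.2]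

lemma LipschitzWith.integrable_of_integrable_norm {F : Type*} [NormedAddCommGroup F]
    [MeasurableSpace F] [BorelSpace F] {μ : Measure F} [IsFiniteMeasure μ]
    (hμ : Integrable (fun z => ‖z‖) μ) {L : ℝ≥0} {h : F → ℝ} (hL : LipschitzWith L h) :
    Integrable h μ := by
  refine ((integrable_const |h 0|).add (hμ.const_mul L)).mono'
    hL.continuous.measurable.aestronglyMeasurable (ae_of_all _ fun z => ?_)
  have := hL.norm_sub_le z 0
  rw [sub_zero] at this
  have h2 := norm_le_norm_add_norm_sub' (h z) (h 0)
  simp only [Real.norm_eq_abs, Pi.add_apply] at *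
  linarith

lemma LipschitzWith.integrable_centredGaussian {L : ℝ≥0} {h : ℝ → ℝ} (hL : LipschitzWith L h)
    (η : ℝ) : Integrable h (centredGaussian η) :=
  hL.integrable_of_integrable_norm (IsGaussian.integrable_id (μ := centredGaussian η)).norm

lemma LipschitzWith.abs_halfWidth_sub_le {L : ℝ≥0} {h : ℝ → ℝ} (hL : LipschitzWith L h)
    {η : ℝ} (hη : 0 ≤ η) (v : ℝ) :
    |h (halfWidth η v) - h (-halfWidth η v)| ≤ 2 * L * halfWidth η v := by
  have := hL.norm_sub_le (halfWidth η v) (-halfWidth η v)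
  rw [sub_neg_eq_add, Real.norm_of_nonneg (add_nonneg (halfWidth_nonneg hη v)
    (halfWidth_nonneg hη v)), Real.norm_eq_abs] at this
  linarith

lemma LipschitzWith.integrable_halfWidth_sub {L : ℝ≥0} {h : ℝ → ℝ} (hL : LipschitzWith L h)
    {η : ℝ} (hη : 0 ≤ η) :
    Integrable (fun v => h (halfWidth η v) - h (-halfWidth η v)) (expMeasure 1) := by
  have := hL.continuous.measurable
  exact ((integrable_halfWidth η).const_mul (2 * L)).mono' (by fun_prop)
    (ae_of_all _ fun v => hL.abs_halfWidth_sub_le hη v)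

lemma abs_centredGaussian_shift_le {L : ℝ≥0} {h : ℝ → ℝ} (hL : LipschitzWith L h) {η : ℝ}
    (hη : 0 < η) (a : ℝ) :
    |∫ u, h (a + u) ∂centredGaussian η - ∫ u, h u ∂centredGaussian η
      - a * ∫ v, 1 / (η * Real.sqrt (2 * Real.pi)) *
        (h (halfWidth η v) - h (-halfWidth η v)) ∂expMeasure 1|
      ≤ 1 / (η * Real.sqrt (2 * Real.pi)) * (2 * L * a ^ 2) := by
  have hLa : LipschitzWith L fun u => h (a + u) := by
    simpa [Function.comp_def] using hL.comp (isometry_add_left a).lipschitz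
  have i1 := hLa.integrable_centredGaussian η
  have i2 := hL.integrable_centredGaussian η
  have m1 := hLa.continuous.measurable
  have m2 := hL.continuous.measurable
  have j1 := integrable_integral_halfWidth hη m1 i1
  have j2 := integrable_integral_halfWidth hη m2 i2
  have j3 := ((hL.integrable_halfWidth_sub hη.le).const_mul
    (1 / (η * Real.sqrt (2 * Real.pi)))).const_mul a
  rw [integral_centredGaussian hη m1 i1, integral_centredGaussian hη m2 i2,
    ← integral_sub j1 j2, ← integral_const_mul, ← integral_sub (by exact j1.sub j2) j3]
  refine (abs_integral_le_integral_abs).trans ?_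
  refine (integral_mono_of_nonneg (ae_of_all _ fun v => abs_nonneg _)
    (integrable_const (1 / (η * Real.sqrt (2 * Real.pi)) * (2 * L * a ^ 2)))
    (ae_of_all _ fun v => ?_)).trans (by simp)
  have hc : 0 ≤ 1 / (η * Real.sqrt (2 * Real.pi)) := by positivity
  have := mul_le_mul_of_nonneg_left (abs_integral_symm_shift_le hL (halfWidth η v) a) hc
  rw [← abs_of_nonneg hc, ← abs_mul, abs_of_nonneg hc] at this
  refine le_of_eq_of_le (congrArg _ ?_) this
  ring

/-! ### Isotropic Gaussian measures -/

/-- The centred Gaussian measure on `ℝⁿ` with covariance matrix `η² I`. -/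
def isoGaussian (n : ℕ) (η : ℝ) : Measure (Rn n) :=
  multivariateGaussian (0 : Rn n) (η ^ 2 • (1 : Matrix (Fin n) (Fin n) ℝ))

instance (n : ℕ) (η : ℝ) : IsGaussian (isoGaussian n η) := by
  unfold isoGaussian
  infer_instance

instance (n : ℕ) (η : ℝ) : IsProbabilityMeasure (isoGaussian n η) := inferInstance

lemma charFun_isoGaussian {n : ℕ} (η : ℝ) (t : Rn n) :
    charFun (isoGaussian n η) t = Complex.exp (-(η ^ 2 * ‖t‖ ^ 2) / 2) := by
  rw [isoGaussian, charFun_multivariateGaussian (Matrix.PosSemidef.one.smul (sq_nonneg η))]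
  congr 1
  rw [Matrix.smul_mulVec, Matrix.one_mulVec, dotProduct_smul, ← Complex.ofReal_pow ‖t‖,
    EuclideanSpace.real_norm_sq_eq]
  simp only [inner_zero_right, dotProduct, smul_eq_mul, ← sq]
  push_cast
  ring

lemma isoGaussian_eq_map_smul (n : ℕ) (η : ℝ) :
    isoGaussian n η = (stdGaussian (Rn n)).map fun z => η • z := by
  refine Measure.ext_of_charFun ?_
  ext t
  rw [charFun_isoGaussian, charFun_map_smul, charFun_stdGaussian, norm_smul]
  congr 1
  rw [Real.norm_eq_abs]
  push_cast
  rw [mul_pow, ← Complex.ofReal_pow |η|, sq_abs]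
  push_cast
  ring

lemma isoGaussian_eq_map_pi (n : ℕ) (η : ℝ) :
    isoGaussian n η = (Measure.pi fun _ => centredGaussian η).map (WithLp.toLp 2) := by
  refine Measure.ext_of_charFun ?_
  ext t
  rw [charFun_isoGaussian, charFun_pi]
  simp_rw [centredGaussian, charFun_gaussianReal]
  rw [← Complex.exp_sum]
  congr 1
  rw [← Complex.ofReal_pow ‖t‖, EuclideanSpace.real_norm_sq_eq, Real.coe_toNNReal _ (sq_nonneg η)]
  simp [Finset.sum_div, Finset.mul_sum, neg_div]

lemma measurable_update_neg {n : ℕ} (i : Fin n) :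
    Measurable fun q : (Fin n → ℝ) × ℝ => Function.update q.1 i (-q.2) := by
  refine measurable_pi_iff.2 fun j => ?_
  rcases eq_or_ne j i with rfl | hj
  · simp only [Function.update_self]
    fun_prop
  · simp only [Function.update_of_ne hj]
    fun_prop

/-- The sign is there because `shiftedPoint` adds its shift in coordinate `i`, whereas the smoothing
subtracts `z`; it is harmless by symmetry of the Gaussian. -/
lemma map_update_neg_pi {n : ℕ} (η : ℝ) (i : Fin n) :
    ((Measure.pi fun _ : Fin n => centredGaussian η).prod (centredGaussian η)).map
      (fun q => Function.update q.1 i (-q.2)) = Measure.pi fun _ => centredGaussian η := by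
  refine (Measure.pi_eq fun s hs => ?_).symm
  rw [Measure.map_apply (measurable_update_neg i) (MeasurableSet.univ_pi hs)]
  have hpre : (fun q : (Fin n → ℝ) × ℝ => Function.update q.1 i (-q.2)) ⁻¹' Set.univ.pi s
      = (Set.univ.pi (Function.update s i Set.univ)) ×ˢ ((fun u => -u) ⁻¹' s i) := by
    ext q
    simp only [Set.mem_preimage, Set.mem_univ_pi, Set.mem_prod]
    constructor
    · refine fun h => ⟨fun j => ?_, by simpa using h i⟩
      rcases eq_or_ne j i with rfl | hj
      · simp
      · simpa [hj] using h j
    · rintro ⟨h1, h2⟩ j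
      rcases eq_or_ne j i with rfl | hj
      · simpa using h2
      · simpa [hj] using h1 j
  have hneg : centredGaussian η ((fun u => -u) ⁻¹' s i) = centredGaussian η (s i) := by
    rw [← Measure.map_apply measurable_neg (hs i), centredGaussian, gaussianReal_map_neg, neg_zero]
  rw [hpre, Measure.prod_prod, Measure.pi_pi, hneg,
    ← Finset.mul_prod_erase _ _ (Finset.mem_univ i), ← Finset.mul_prod_erase _ _ (Finset.mem_univ i)]
  simp only [Function.update_self, measure_univ, one_mul]
  rw [mul_comm]
  congr 1
  refine Finset.prod_congr rfl fun j hj => ?_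
  rw [Function.update_of_ne (Finset.ne_of_mem_erase hj)]

lemma measurable_resample {n : ℕ} (i : Fin n) :
    Measurable fun q : Rn n × ℝ =>
      (WithLp.toLp 2 (Function.update q.1.ofLp i (-q.2)) : Rn n) := by
  exact (WithLp.measurable_toLp 2 _).comp ((measurable_update_neg i).comp
    (((WithLp.measurable_ofLp 2 _).comp measurable_fst).prodMk measurable_snd))

/-- Replacing one coordinate of an isotropic Gaussian vector by an independent copy keeps its
law. -/
lemma map_resample_isoGaussian {n : ℕ} (η : ℝ) (i : Fin n) :
    ((isoGaussian n η).prod (centredGaussian η)).map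
      (fun q => WithLp.toLp 2 (Function.update q.1.ofLp i (-q.2))) = isoGaussian n η := by
  have h1 : (isoGaussian n η).prod (centredGaussian η)
      = ((Measure.pi fun _ : Fin n => centredGaussian η).prod (centredGaussian η)).map
        (Prod.map (WithLp.toLp 2) id) := by
    rw [← Measure.map_prod_map _ _ (WithLp.measurable_toLp 2 _) measurable_id, Measure.map_id,
      isoGaussian_eq_map_pi]
  rw [h1, Measure.map_map (measurable_resample i)
    ((WithLp.measurable_toLp 2 _).prodMap measurable_id)]
  conv_rhs => rw [isoGaussian_eq_map_pi, ← map_update_neg_pi η i,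
    Measure.map_map (WithLp.measurable_toLp 2 _) (measurable_update_neg i)]
  rfl

lemma integrable_norm_isoGaussian (n : ℕ) (η : ℝ) :
    Integrable (fun z => ‖z‖) (isoGaussian n η) :=
  (IsGaussian.integrable_id (μ := isoGaussian n η)).norm

lemma integral_norm_isoGaussian (n : ℕ) {η : ℝ} (hη : 0 ≤ η) :
    ∫ z, ‖z‖ ∂isoGaussian n η = η * ∫ z, ‖z‖ ∂stdGaussian (Rn n) := by
  rw [isoGaussian_eq_map_smul, integral_map (by fun_prop) (by fun_prop), ← integral_const_mul]
  simp [norm_smul, abs_of_nonneg hη]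

lemma LipschitzWith.integrable_isoGaussian {n : ℕ} {L : ℝ≥0} {f : Rn n → ℝ}
    (hL : LipschitzWith L f) (η : ℝ) : Integrable f (isoGaussian n η) :=
  hL.integrable_of_integrable_norm (integrable_norm_isoGaussian n η)

/-! ### Shifted points -/

section shiftedPoint

variable {n : ℕ}

lemma shiftedPoint_eq_sub (x z : Rn n) (i : Fin n) (s : ℝ) :
    shiftedPoint x z i s = x - WithLp.toLp 2 (Function.update z.ofLp i (-s)) := by
  ext j
  rcases eq_or_ne j i with rfl | hj
  · simp [shiftedPoint]
  · simp [shiftedPoint, hj]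

lemma shiftedPoint_add_single (x z : Rn n) (i : Fin n) (a s : ℝ) :
    shiftedPoint (x + EuclideanSpace.single i a) z i s = shiftedPoint x z i (a + s) := by
  ext j
  rcases eq_or_ne j i with rfl | hj
  · simp [shiftedPoint, add_assoc]
  · simp [shiftedPoint, hj]

lemma shiftedPoint_sub_shiftedPoint (x y z : Rn n) (i : Fin n) (s : ℝ) :
    shiftedPoint x z i s - shiftedPoint y z i s = x - y := by
  rw [shiftedPoint_eq_sub, shiftedPoint_eq_sub, sub_sub_sub_cancel_right]

lemma norm_shiftedPoint_sub_shiftedPoint (x z : Rn n) (i : Fin n) (s t : ℝ) :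
    ‖shiftedPoint x z i s - shiftedPoint x z i t‖ = |s - t| := by
  have : shiftedPoint x z i s - shiftedPoint x z i t = EuclideanSpace.single i (s - t) := by
    ext j
    rcases eq_or_ne j i with rfl | hj
    · simp [shiftedPoint]
    · simp [shiftedPoint, hj]
  rw [this, PiLp.norm_single, Real.norm_eq_abs]

lemma measurable_shiftedPoint (i : Fin n) :
    Measurable fun q : Rn n × Rn n × ℝ => shiftedPoint q.1 q.2.1 i q.2.2 := by
  simp_rw [shiftedPoint_eq_sub]
  exact measurable_fst.sub ((measurable_resample i).comp measurable_snd)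

lemma Measurable.shiftedPoint {α : Type*} [MeasurableSpace α] {x z : α → Rn n} {s : α → ℝ}
    (hx : Measurable x) (hz : Measurable z) (hs : Measurable s) (i : Fin n) :
    Measurable fun a => shiftedPoint (x a) (z a) i (s a) :=
  (measurable_shiftedPoint i).comp (hx.prodMk (hz.prodMk hs))

lemma LipschitzWith.comp_shiftedPoint {L : ℝ≥0} {f : Rn n → ℝ} (hL : LipschitzWith L f)
    (x z : Rn n) (i : Fin n) : LipschitzWith L fun s => f (_root_.shiftedPoint x z i s) := by
  refine LipschitzWith.of_dist_le_mul fun s t => ?_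
  refine (hL.dist_le_mul _ _).trans ?_
  rw [dist_eq_norm, norm_shiftedPoint_sub_shiftedPoint, Real.dist_eq]

end shiftedPoint

/-! ### The Gaussian smoothing and the mean of the estimator -/

section smoothing

variable {n : ℕ}

/-- The Gaussian smoothing of `f` with standard deviation `η`. -/
def smoothing (η : ℝ) (f : Rn n → ℝ) (x : Rn n) : ℝ := ∫ z, f (x - z) ∂isoGaussian n η

/-- The expectation of the estimator for the function `f`. -/
def esGsMean (η : ℝ) (f : Rn n → ℝ) (x : Rn n) : Rn n :=
  WithLp.toLp 2 fun i => ∫ q, esGs η f x q.1 q.2 i ∂(expMeasure 1).prod (isoGaussian n η)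

lemma esGs_apply (η : ℝ) (f : Rn n → ℝ) (x : Rn n) (v : ℝ) (z : Rn n) (i : Fin n) :
    esGs η f x v z i = 1 / (η * Real.sqrt (2 * Real.pi)) *
      (f (shiftedPoint x z i (halfWidth η v)) - f (shiftedPoint x z i (-halfWidth η v))) := rfl

lemma esGsMean_apply (η : ℝ) (f : Rn n → ℝ) (x : Rn n) (i : Fin n) :
    esGsMean η f x i
      = ∫ q, esGs η f x q.1 q.2 i ∂(expMeasure 1).prod (isoGaussian n η) := rfl

lemma LipschitzWith.comp_const_sub {L : ℝ≥0} {f : Rn n → ℝ} (hL : LipschitzWith L f) (x : Rn n) :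
    LipschitzWith L fun z => f (x - z) :=
  LipschitzWith.of_dist_le_mul fun y z => (hL.dist_le_mul _ _).trans (by rw [dist_sub_left])

lemma integrable_comp_shiftedPoint {L : ℝ≥0} {f : Rn n → ℝ} (hL : LipschitzWith L f) (η : ℝ)
    (x : Rn n) (i : Fin n) :
    Integrable (fun q : Rn n × ℝ => f (shiftedPoint x q.1 i q.2))
      ((isoGaussian n η).prod (centredGaussian η)) := by
  have hL' := hL.comp_const_sub x
  have h := hL'.integrable_isoGaussian η
  rw [← map_resample_isoGaussian η i,
    integrable_map_measure hL'.continuous.measurable.aestronglyMeasurable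
      (measurable_resample i).aemeasurable] at h
  simp_rw [shiftedPoint_eq_sub]
  exact h

/-- Resampling coordinate `i` isolates it in an independent variable `u`, so the expansion on the
line applies with `z` frozen. -/
lemma smoothing_eq_integral_shiftedPoint {L : ℝ≥0} {f : Rn n → ℝ} (hL : LipschitzWith L f) (η : ℝ)
    (x : Rn n) (i : Fin n) :
    smoothing η f x
      = ∫ z, ∫ u, f (shiftedPoint x z i u) ∂centredGaussian η ∂isoGaussian n η := by
  rw [← integral_prod _ (integrable_comp_shiftedPoint hL η x i), smoothing,
    ← map_resample_isoGaussian η i, integral_map (measurable_resample i).aemeasurable,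
    map_resample_isoGaussian η i]
  · simp_rw [shiftedPoint_eq_sub]
  · have := hL.continuous
    exact (by fun_prop : Continuous fun z => f (x - z)).measurable.aestronglyMeasurable

lemma abs_esGs_le {L : ℝ≥0} {f : Rn n → ℝ} (hL : LipschitzWith L f) {η : ℝ} (hη : 0 ≤ η)
    (x : Rn n) (v : ℝ) (z : Rn n) (i : Fin n) :
    |esGs η f x v z i| ≤ 1 / (η * Real.sqrt (2 * Real.pi)) * (2 * L * halfWidth η v) := by
  rw [esGs_apply, abs_mul, abs_of_nonneg (show 0 ≤ 1 / (η * Real.sqrt (2 * Real.pi)) by positivity)]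
  gcongr
  exact (hL.comp_shiftedPoint x z i).abs_halfWidth_sub_le hη v

lemma measurable_esGs_apply {α : Type*} [MeasurableSpace α] {G : α → Rn n → ℝ}
    (hG : Measurable fun q : Rn n × α => G q.2 q.1) (η : ℝ) {x z : α → Rn n} {v : α → ℝ}
    (hx : Measurable x) (hv : Measurable v) (hz : Measurable z) (i : Fin n) :
    Measurable fun a => esGs η (G a) (x a) (v a) (z a) i := by
  simp_rw [esGs_apply]
  have hh := (measurable_halfWidth η).comp hv
  exact ((hG.comp ((hx.shiftedPoint hz hh i).prodMk measurable_id)).sub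
    (hG.comp ((hx.shiftedPoint hz hh.neg i).prodMk measurable_id))).const_mul _

lemma integrable_esGs {L : ℝ≥0} {f : Rn n → ℝ} (hL : LipschitzWith L f) {η : ℝ} (hη : 0 ≤ η)
    (x : Rn n) (i : Fin n) :
    Integrable (fun q : ℝ × Rn n => esGs η f x q.1 q.2 i)
      ((expMeasure 1).prod (isoGaussian n η)) := by
  refine (((integrable_halfWidth η).const_mul
    (1 / (η * Real.sqrt (2 * Real.pi)) * (2 * L))).comp_fst (isoGaussian n η)).mono' ?_ ?_
  · exact (measurable_esGs_apply (hL.continuous.measurable.comp measurable_fst) η measurable_const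
      measurable_fst measurable_snd i).aestronglyMeasurable
  · refine ae_of_all _ fun q => (abs_esGs_le hL hη x q.1 q.2 i).trans_eq ?_
    ring

lemma abs_smoothing_add_single_le {L : ℝ≥0} {f : Rn n → ℝ} (hL : LipschitzWith L f) {η : ℝ}
    (hη : 0 < η) (x : Rn n) (i : Fin n) (a : ℝ) :
    |smoothing η f (x + EuclideanSpace.single i a) - smoothing η f x - a * esGsMean η f x i|
      ≤ 1 / (η * Real.sqrt (2 * Real.pi)) * (2 * L * a ^ 2) := by
  have i1 := (integrable_comp_shiftedPoint hL η (x + EuclideanSpace.single i a) i).integral_prod_left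
  have i2 := (integrable_comp_shiftedPoint hL η x i).integral_prod_left
  have i3 := (integrable_esGs hL hη.le x i).integral_prod_right
  rw [smoothing_eq_integral_shiftedPoint hL η _ i, smoothing_eq_integral_shiftedPoint hL η x i,
    esGsMean_apply, integral_prod_symm _ (integrable_esGs hL hη.le x i)]
  dsimp only at i1 i2 i3 ⊢
  rw [← integral_sub i1 i2, ← integral_const_mul,
    ← integral_sub (by exact i1.sub i2) (i3.const_mul a)]
  refine (abs_integral_le_integral_abs).trans ?_
  refine (integral_mono_of_nonneg (ae_of_all _ fun v => abs_nonneg _)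
    (integrable_const (1 / (η * Real.sqrt (2 * Real.pi)) * (2 * L * a ^ 2)))
    (ae_of_all _ fun z => ?_)).trans (by simp)
  simp only [shiftedPoint_add_single]
  exact abs_centredGaussian_shift_le (hL.comp_shiftedPoint x z i) hη a

/-- For each draw both evaluation points move by exactly `x - y`, so the numerator changes by at
most `2 L ‖x - y‖`. -/
lemma abs_esGsMean_sub_le {L : ℝ≥0} {f : Rn n → ℝ} (hL : LipschitzWith L f) {η : ℝ}
    (hη : 0 ≤ η) (x y : Rn n) (i : Fin n) :
    |esGsMean η f x i - esGsMean η f y i|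
      ≤ 1 / (η * Real.sqrt (2 * Real.pi)) * (2 * L * ‖x - y‖) := by
  rw [esGsMean_apply, esGsMean_apply]
  dsimp only
  rw [← integral_sub (integrable_esGs hL hη x i) (integrable_esGs hL hη y i)]
  refine (abs_integral_le_integral_abs).trans ?_
  refine (integral_mono_of_nonneg (ae_of_all _ fun v => abs_nonneg _)
    (integrable_const (1 / (η * Real.sqrt (2 * Real.pi)) * (2 * L * ‖x - y‖)))
    (ae_of_all _ fun q => ?_)).trans (by simp)
  have hc : 0 ≤ 1 / (η * Real.sqrt (2 * Real.pi)) := by positivity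
  simp only [esGs_apply]
  rw [← mul_sub, abs_mul, abs_of_nonneg hc]
  refine mul_le_mul_of_nonneg_left ?_ hc
  have h1 := fun s => hL.norm_sub_le (shiftedPoint x q.2 i s) (shiftedPoint y q.2 i s)
  simp only [shiftedPoint_sub_shiftedPoint, Real.norm_eq_abs] at h1
  have h2 := abs_le.1 (h1 (halfWidth η q.1))
  have h3 := abs_le.1 (h1 (-halfWidth η q.1))
  rw [abs_le]
  constructor <;> linarith [h2.1, h2.2, h3.1, h3.2]

lemma continuous_esGsMean {L : ℝ≥0} {f : Rn n → ℝ} (hL : LipschitzWith L f) {η : ℝ}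
    (hη : 0 ≤ η) : Continuous (esGsMean η f) := by
  refine (PiLp.continuous_toLp 2 _).comp (continuous_pi fun i => ?_)
  refine (LipschitzWith.of_dist_le_mul (K := Real.toNNReal
    (1 / (η * Real.sqrt (2 * Real.pi)) * (2 * L))) fun x y => ?_).continuous
  rw [Real.coe_toNNReal _ (by positivity), dist_eq_norm x y, Real.dist_eq]
  exact (abs_esGsMean_sub_le hL hη x y i).trans_eq (by ring)

lemma one_div_mul_sqrt_two_pi_le {η : ℝ} (hη : 0 < η) :
    1 / (η * Real.sqrt (2 * Real.pi)) ≤ 1 / η := by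
  refine one_div_le_one_div_of_le hη (le_mul_of_one_le_right hη.le ?_)
  rw [Real.one_le_sqrt]
  linarith [Real.pi_gt_three]

lemma norm_sum_single_le (s : Finset (Fin n)) (d : Rn n) :
    ‖∑ i ∈ s, EuclideanSpace.single i (d i)‖ ≤ ‖d‖ := by
  refine le_of_sq_le_sq ?_ (norm_nonneg d)
  rw [EuclideanSpace.real_norm_sq_eq, EuclideanSpace.real_norm_sq_eq]
  refine Finset.sum_le_sum fun j _ => ?_
  have : (∑ i ∈ s, EuclideanSpace.single i (d i) : Rn n) j = if j ∈ s then d j else 0 := by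
    simp [Pi.single_apply]
  rw [this]
  split_ifs
  · exact le_rfl
  · simpa using sq_nonneg (d j)

/-- The smoothing of a Lipschitz function is smooth, and the mean of the estimator is its
gradient. -/
lemma abs_smoothing_add_sub_inner_le {L : ℝ≥0} {f : Rn n → ℝ} (hL : LipschitzWith L f) {η : ℝ}
    (hη : 0 < η) (x d : Rn n) :
    |smoothing η f (x + d) - smoothing η f x - inner ℝ (esGsMean η f x) d|
      ≤ 4 * n * L / η * ‖d‖ ^ 2 := by
  -- Move along the coordinates of `d` one at a time. Each move costs one expansion remainder and
  -- one replacement of the gradient at the intermediate point `y` by that at `x`, each at most `2 L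
  -- ‖d‖² / η`; hence the constant `4 n L / η`.
  have key : ∀ s : Finset (Fin n),
      |smoothing η f (x + ∑ i ∈ s, EuclideanSpace.single i (d i)) - smoothing η f x
        - ∑ i ∈ s, d i * esGsMean η f x i| ≤ s.card * (4 * L / η * ‖d‖ ^ 2) := by
    intro s
    induction s using Finset.induction_on with
    | empty => simp
    | insert i s hi ih =>
      set y := x + ∑ i ∈ s, EuclideanSpace.single i (d i) with hy
      have hdi : |d i| ≤ ‖d‖ := PiLp.norm_apply_le d i
      have hc := one_div_mul_sqrt_two_pi_le hη
      have hc0 : 0 ≤ 1 / (η * Real.sqrt (2 * Real.pi)) := by positivity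
      have e1 : |smoothing η f (y + EuclideanSpace.single i (d i)) - smoothing η f y
          - d i * esGsMean η f y i| ≤ 1 / η * (2 * L * ‖d‖ ^ 2) := by
        refine (abs_smoothing_add_single_le hL hη y i (d i)).trans ?_
        rw [← sq_abs (d i)]
        gcongr
      have e2 : |d i * (esGsMean η f y i - esGsMean η f x i)| ≤ 1 / η * (2 * L * ‖d‖ ^ 2) := by
        have h1 := abs_esGsMean_sub_le hL hη.le y x i
        have h2 : ‖y - x‖ ≤ ‖d‖ := by
          rw [hy, add_sub_cancel_left]
          exact norm_sum_single_le s d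
        rw [abs_mul]
        calc |d i| * |esGsMean η f y i - esGsMean η f x i|
            ≤ ‖d‖ * (1 / η * (2 * L * ‖d‖)) := by
              gcongr
              refine h1.trans ?_
              gcongr
          _ = _ := by ring
      rw [Finset.sum_insert hi, Finset.sum_insert hi, Finset.card_insert_of_notMem hi,
        add_comm (EuclideanSpace.single i (d i)), ← add_assoc, ← hy]
      have e3 : ((s.card + 1 : ℕ) : ℝ) * (4 * L / η * ‖d‖ ^ 2) = s.card * (4 * L / η * ‖d‖ ^ 2)
          + 1 / η * (2 * L * ‖d‖ ^ 2) + 1 / η * (2 * L * ‖d‖ ^ 2) := by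
        push_cast
        ring
      rw [e3]
      rw [abs_le] at ih e1 e2 ⊢
      constructor <;> linarith [ih.1, ih.2, e1.1, e1.2, e2.1, e2.2]
  have h := key Finset.univ
  have hd : ∑ i, EuclideanSpace.single i (d i) = d := by
    ext j
    simp [Pi.single_apply]
  rw [hd] at h
  have hi : inner ℝ (esGsMean η f x) d = ∑ i, d i * esGsMean η f x i := by
    simp [PiLp.inner_apply]
  rw [hi]
  refine h.trans_eq ?_
  rw [Finset.card_univ, Fintype.card_fin]
  ring

/-- The two evaluation points are `2 η √(2v)` apart, which cancels the factor `1/η`: the bound is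
uniform in `η`. -/
lemma norm_esGsMean_le {L : ℝ≥0} {f : Rn n → ℝ} (hL : LipschitzWith L f) {η : ℝ}
    (hη : 0 < η) (x : Rn n) :
    ‖esGsMean η f x‖ ≤ n * (2 * L * ∫ v, halfWidth 1 v ∂expMeasure 1) := by
  have h1 : ∀ i, |esGsMean η f x i| ≤ 2 * L * ∫ v, halfWidth 1 v ∂expMeasure 1 := by
    intro i
    rw [esGsMean_apply, integral_prod _ (integrable_esGs hL hη.le x i),
      ← integral_const_mul]
    refine (abs_integral_le_integral_abs).trans ?_
    refine integral_mono_of_nonneg (ae_of_all _ fun v => abs_nonneg _)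
      ((integrable_halfWidth 1).const_mul _) (ae_of_all _ fun v => ?_)
    refine (abs_integral_le_integral_abs).trans ?_
    refine (integral_mono_of_nonneg (ae_of_all _ fun v => abs_nonneg _)
      (integrable_const (2 * L * halfWidth 1 v)) (ae_of_all _ fun z => ?_)).trans (by simp)
    refine (abs_esGs_le hL hη.le x v z i).trans ?_
    have h2 : halfWidth η v = η * halfWidth 1 v := by simp [halfWidth]
    calc 1 / (η * Real.sqrt (2 * Real.pi)) * (2 * L * halfWidth η v)
        ≤ 1 / η * (2 * L * halfWidth η v) := by
          have := halfWidth_nonneg hη.le v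
          exact mul_le_mul_of_nonneg_right (one_div_mul_sqrt_two_pi_le hη) (by positivity)
      _ = _ := by
          rw [h2]
          field_simp
  have h3 : ‖esGsMean η f x‖ ≤ ∑ i, |esGsMean η f x i| := by
    have hd : ∑ i, EuclideanSpace.single i (esGsMean η f x i) = esGsMean η f x := by
      ext j
      simp [Pi.single_apply]
    conv_lhs => rw [← hd]
    refine (norm_sum_le _ _).trans (Finset.sum_le_sum fun i _ => ?_)
    rw [PiLp.norm_single, Real.norm_eq_abs]
  refine h3.trans ((Finset.sum_le_sum fun i _ => h1 i).trans ?_)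
  simp

/-- Both smoothings are coupled by scaling the same standard Gaussian vector. -/
lemma abs_smoothing_sub_smoothing_le {L : ℝ≥0} {f : Rn n → ℝ} (hL : LipschitzWith L f)
    (η η' : ℝ) (x : Rn n) :
    |smoothing η f x - smoothing η' f x|
      ≤ L * |η - η'| * ∫ z, ‖z‖ ∂stdGaussian (Rn n) := by
  have hm := (hL.comp_const_sub x).continuous.measurable
  have hs : ∀ η, smoothing η f x = ∫ z, f (x - η • z) ∂stdGaussian (Rn n) := fun η => by
    rw [smoothing, isoGaussian_eq_map_smul, integral_map (by fun_prop) hm.aestronglyMeasurable]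
  have hi : ∀ η : ℝ, Integrable (fun z => f (x - η • z)) (stdGaussian (Rn n)) := fun η => by
    have := (hL.comp_const_sub x).integrable_isoGaussian η
    rw [isoGaussian_eq_map_smul, integrable_map_measure hm.aestronglyMeasurable (by fun_prop)]
      at this
    exact this
  rw [hs, hs, ← integral_sub (hi η) (hi η'), ← integral_const_mul]
  refine (abs_integral_le_integral_abs).trans ?_
  refine integral_mono_of_nonneg (ae_of_all _ fun v => abs_nonneg _)
    (IsGaussian.integrable_id.norm.const_mul _) (ae_of_all _ fun z => ?_)
  refine (hL.norm_sub_le _ _).trans_eq ?_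
  rw [sub_sub_sub_cancel_left, ← sub_smul, norm_smul, Real.norm_eq_abs, abs_sub_comm]
  simp [mul_assoc]

lemma abs_smoothing_sub_le {L : ℝ≥0} {f : Rn n → ℝ} (hL : LipschitzWith L f)
    (η : ℝ) (x y : Rn n) : |smoothing η f x - smoothing η f y| ≤ L * ‖x - y‖ := by
  rw [smoothing, smoothing, ← integral_sub ((hL.comp_const_sub x).integrable_isoGaussian η)
    ((hL.comp_const_sub y).integrable_isoGaussian η)]
  refine (abs_integral_le_integral_abs).trans ?_
  refine (integral_mono_of_nonneg (ae_of_all _ fun v => abs_nonneg _)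
    (integrable_const (L * ‖x - y‖)) (ae_of_all _ fun z => ?_)).trans (by simp)
  simpa using hL.norm_sub_le (x - z) (y - z)

end smoothing

/-! ### Consistency of the smoothed gradients with the Clarke subdifferential -/

/-- If `‖z‖ < δ/2`, then `x - z` is `δ`-close to `xs` and the quotient bound applies. Otherwise only
the Lipschitz bound `L ‖v‖` holds, and `(2/δ) ‖z‖ ≥ 1` pays for the excess over `c`. The joint bound
is affine in `‖z‖`, so its Gaussian mean is `c + O(η)`. -/
lemma sub_le_of_quotient_lt {n : ℕ} {L : ℝ≥0} {f : Rn n → ℝ} (hL : LipschitzWith L f)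
    {x xs v z : Rn n} {c δ t : ℝ} (hc : c < 0) (hδ : 0 < δ) (ht : 0 < t) (hx : ‖x - xs‖ < δ / 2)
    (hq : ∀ y, ‖y - xs‖ < δ → (f (y + t • v) - f y) / t < c) :
    f (x + t • v - z) - f (x - z) ≤ t * (c + (L * ‖v‖ - c) * (2 / δ) * ‖z‖) := by
  have hLv : 0 ≤ L * ‖v‖ := by positivity
  rw [show x + t • v - z = x - z + t • v by abel]
  rcases lt_or_ge ‖z‖ (δ / 2) with hz | hz
  · have h1 : ‖x - z - xs‖ < δ := by
      rw [show x - z - xs = (x - xs) - z by abel]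
      exact (norm_sub_le _ _).trans_lt (by linarith)
    have h2 := (div_lt_iff₀ ht).1 (hq _ h1)
    have h3 : 0 ≤ t * ((L * ‖v‖ - c) * (2 / δ) * ‖z‖) := by
      have : 0 ≤ L * ‖v‖ - c := by linarith
      positivity
    linarith
  · have h1 := (le_abs_self _).trans (hL.norm_sub_le (x - z + t • v) (x - z))
    rw [add_sub_cancel_left, norm_smul, Real.norm_of_nonneg ht.le] at h1
    have h2 : 1 ≤ 2 / δ * ‖z‖ := by
      rw [div_mul_eq_mul_div, one_le_div hδ]
      linarith
    have h3 : L * ‖v‖ ≤ c + (L * ‖v‖ - c) * (2 / δ) * ‖z‖ := by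
      nlinarith
    have h4 := mul_le_mul_of_nonneg_left h3 ht.le
    linarith

lemma inner_esGsMean_le {n : ℕ} {L : ℝ≥0} {f : Rn n → ℝ} (hL : LipschitzWith L f)
    {x xs v : Rn n} {c δ η : ℝ} (hη : 0 < η) (hc : c < 0) (hδ : 0 < δ) (hx : ‖x - xs‖ < δ / 2)
    (hq : ∀ᶠ t in 𝓝[>] (0 : ℝ), ∀ y, ‖y - xs‖ < δ → (f (y + t • v) - f y) / t < c) :
    inner ℝ (esGsMean η f x) v
      ≤ c + (L * ‖v‖ - c) * (2 / δ) * (η * ∫ z, ‖z‖ ∂stdGaussian (Rn n)) := by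
  -- With `η` fixed, the quadratic remainder divided by `t` vanishes as `t ↓ 0`, which turns the
  -- increment bound into one on the gradient.
  have hlim : Tendsto (fun t : ℝ => c + (L * ‖v‖ - c) * (2 / δ) *
      (η * ∫ z, ‖z‖ ∂stdGaussian (Rn n)) + t * (4 * n * L / η * ‖v‖ ^ 2)) (𝓝[>] (0 : ℝ))
      (𝓝 (c + (L * ‖v‖ - c) * (2 / δ) * (η * ∫ z, ‖z‖ ∂stdGaussian (Rn n)))) := by
    refine Tendsto.mono_left ?_ nhdsWithin_le_nhds
    refine (Continuous.tendsto' (by fun_prop) _ _ (by simp))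
  refine ge_of_tendsto hlim ?_
  filter_upwards [hq, self_mem_nhdsWithin] with t hq ht
  replace ht : 0 < t := ht
  have i1 := (hL.comp_const_sub (x + t • v)).integrable_isoGaussian η
  have i2 := (hL.comp_const_sub x).integrable_isoGaussian η
  have h1 : smoothing η f (x + t • v) - smoothing η f x
      ≤ t * (c + (L * ‖v‖ - c) * (2 / δ) * (η * ∫ z, ‖z‖ ∂stdGaussian (Rn n))) := by
    have hn := integrable_norm_isoGaussian n η
    rw [smoothing, smoothing, ← integral_sub i1 i2, ← integral_norm_isoGaussian n hη.le]
    refine (integral_mono (i1.sub i2) (((integrable_const c).add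
      (hn.const_mul ((L * ‖v‖ - c) * (2 / δ)))).const_mul t) fun z => sub_le_of_quotient_lt hL hc hδ ht hx hq).trans_eq ?_
    rw [integral_const_mul, integral_add' (integrable_const c) (hn.const_mul _), integral_const_mul]
    simp
  have h2 := (abs_le.1 (abs_smoothing_add_sub_inner_le hL hη x (t • v))).1
  rw [inner_smul_right, norm_smul, Real.norm_of_nonneg ht.le, mul_pow] at h2
  refine le_of_mul_le_mul_left ?_ ht
  nlinarith

/-- A limit of points at which the smoothed gradients tend to `0` is Clarke stationary. -/
theorem zero_mem_clarkeSubdifferential {n : ℕ} {L : ℝ≥0} {f : Rn n → ℝ} (hL : LipschitzWith L f)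
    {η : ℕ → ℝ} (hη : ∀ j, 0 < η j) (hη0 : Tendsto η atTop (𝓝 0)) {x : ℕ → Rn n} {xs : Rn n}
    (hx : Tendsto x atTop (𝓝 xs))
    (hg : Tendsto (fun j => esGsMean (η j) f (x j)) atTop (𝓝 0)) :
    (0 : Rn n) ∈ clarkeSubdifferential f xs := by
  intro v
  rw [inner_zero_left, EReal.coe_zero]
  by_contra! h
  -- A negative `c` strictly above `h°(xs, v)` bounds the limit of the directional derivatives,
  -- which is `0`: a contradiction.
  obtain ⟨c, hc1, hc2⟩ := EReal.lt_iff_exists_real_btwn.1 h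
  have hc : c < 0 := by exact_mod_cast hc2
  have hev := eventually_lt_of_limsup_lt hc1
  obtain ⟨pa, hpa, pb, hpb, hab⟩ := eventually_prod_iff.1 hev
  obtain ⟨δ, hδ, hball⟩ := Metric.eventually_nhds_iff.1 hpa
  have hq : ∀ᶠ t in 𝓝[>] (0 : ℝ), ∀ y, ‖y - xs‖ < δ → (f (y + t • v) - f y) / t < c := by
    filter_upwards [hpb] with t ht y hy
    have := hab (hball (by rwa [dist_eq_norm])) ht
    exact_mod_cast this
  have hnear : ∀ᶠ j in atTop, ‖x j - xs‖ < δ / 2 := by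
    have := Metric.tendsto_nhds.1 hx (δ / 2) (by positivity)
    simpa only [dist_eq_norm] using this
  have h1 : Tendsto (fun j => inner ℝ (esGsMean (η j) f (x j)) v) atTop (𝓝 0) := by
    simpa using hg.inner (tendsto_const_nhds (x := v))
  have h2 : Tendsto (fun j => c + (L * ‖v‖ - c) * (2 / δ) *
      (η j * ∫ z, ‖z‖ ∂stdGaussian (Rn n))) atTop (𝓝 c) := by
    simpa using ((hη0.mul_const (∫ z, ‖z‖ ∂stdGaussian (Rn n))).const_mul
      ((L * ‖v‖ - c) * (2 / δ))).const_add c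
  have h3 := le_of_tendsto_of_tendsto h1 h2 (hnear.mono fun j hj =>
    inner_esGsMean_le hL (hη j) hc hδ hj hq)
  linarith

/-! ### Deterministic subsequences -/

lemma frequently_lt_of_tsum_mul_ne_top {γ : ℕ → ℝ} (hγ : ∀ k, 0 < γ k)
    (hsum : Tendsto (fun K => ∑ k ∈ Finset.range K, γ k) atTop atTop) {q : ℕ → ℝ≥0∞}
    (hq : ∑' k, ENNReal.ofReal (γ k) * q k ≠ ∞) {ε : ℝ≥0∞} (hε : ε ≠ 0) :
    ∃ᶠ k in atTop, q k < ε := by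
  intro hev
  obtain ⟨N, hN⟩ := eventually_atTop.1 hev
  have h1 : ∀ K, ENNReal.ofReal (∑ k ∈ Finset.range K, γ k - ∑ k ∈ Finset.range N, γ k) * ε
      ≤ ∑' k, ENNReal.ofReal (γ k) * q k := by
    intro K
    rcases le_total K N with hK | hK
    · have := Finset.sum_le_sum_of_subset_of_nonneg (Finset.range_mono hK)
        fun i _ _ => (hγ i).le
      rw [ENNReal.ofReal_of_nonpos (by linarith), zero_mul]
      exact zero_le
    · rw [← Finset.sum_Ico_eq_sub _ hK, ENNReal.ofReal_sum_of_nonneg fun i _ => (hγ i).le,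
        Finset.sum_mul]
      refine (Finset.sum_le_sum fun i hi => ?_).trans (ENNReal.sum_le_tsum (Finset.Ico N K))
      have := not_lt.1 (hN i (Finset.mem_Ico.1 hi).1)
      gcongr
  have h2 : Tendsto (fun K => ENNReal.ofReal (∑ k ∈ Finset.range K, γ k
      - ∑ k ∈ Finset.range N, γ k) * ε) atTop (𝓝 (∞ * ε)) :=
    ENNReal.Tendsto.mul_const (ENNReal.tendsto_ofReal_atTop.comp
      (tendsto_atTop_add_const_right _ _ hsum)) (Or.inl (by simp))
  rw [ENNReal.top_mul hε] at h2
  exact hq (top_le_iff.1 (le_of_tendsto' h2 h1))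

/-- The random sum `T` need not be integrable, but after weighting by `(1 + T)⁻¹` it has mean at
most `1`. Indices can then be chosen from expectations alone, hence deterministically: weighted
means below `2⁻ʲ` are summable, so the weighted terms tend to `0` almost surely, and the finite
factor `1 + T` restores the original ones. -/
lemma exists_strictMono_ae_tendsto_zero {Ω : Type*} [MeasurableSpace Ω] {P : Measure Ω}
    [IsProbabilityMeasure P] {γ : ℕ → ℝ} (hγ : ∀ k, 0 < γ k)
    (hsum : Tendsto (fun K => ∑ k ∈ Finset.range K, γ k) atTop atTop) {φ : ℕ → Ω → ℝ≥0∞}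
    (hφ : ∀ k, Measurable (φ k)) (hfin : ∀ᵐ ω ∂P, ∑' k, ENNReal.ofReal (γ k) * φ k ω ≠ ∞) :
    ∃ a : ℕ → ℕ, StrictMono a ∧ ∀ᵐ ω ∂P, Tendsto (fun j => φ (a j) ω) atTop (𝓝 0) := by
  set T : Ω → ℝ≥0∞ := fun ω => ∑' k, ENNReal.ofReal (γ k) * φ k ω with hT
  have hTm : Measurable T := Measurable.tsum fun k => (hφ k).const_mul _
  have hmeas : ∀ k, Measurable fun ω => φ k ω * (1 + T ω)⁻¹ := fun k =>
    (hφ k).mul (hTm.const_add 1).inv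
  have hq : ∑' k, ENNReal.ofReal (γ k) * ∫⁻ ω, φ k ω * (1 + T ω)⁻¹ ∂P ≠ ∞ := by
    simp_rw [← lintegral_const_mul _ (hmeas _)]
    rw [← lintegral_tsum fun k => ((hmeas k).const_mul _).aemeasurable]
    refine ne_top_of_le_ne_top ENNReal.one_ne_top
      ((lintegral_mono (g := fun _ => 1) fun ω => ?_).trans (by simp))
    simp_rw [← mul_assoc]
    rw [ENNReal.tsum_mul_right, ← div_eq_mul_inv]
    exact ENNReal.div_le_of_le_mul (by simp [hT])
  obtain ⟨a, ha, hlt⟩ := extraction_forall_of_frequently fun j =>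
    frequently_lt_of_tsum_mul_ne_top hγ hsum hq (ε := (2⁻¹ : ℝ≥0∞) ^ j) (by simp)
  refine ⟨a, ha, ?_⟩
  have hint : ∫⁻ ω, ∑' j, φ (a j) ω * (1 + T ω)⁻¹ ∂P ≠ ∞ := by
    rw [lintegral_tsum fun j => (hmeas (a j)).aemeasurable]
    refine ne_top_of_le_ne_top ?_ (ENNReal.tsum_le_tsum fun j => (hlt j).le)
    rw [ENNReal.tsum_geometric]
    simp
  have hae := ae_lt_top (Measurable.tsum fun j => hmeas (a j)) hint
  filter_upwards [hae, hfin] with ω h1 h2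
  have h3 := ENNReal.tendsto_atTop_zero_of_tsum_ne_top h1.ne
  have hne : 1 + T ω ≠ ∞ := by simpa using h2
  have h4 := ENNReal.Tendsto.mul_const (b := 1 + T ω) h3 (Or.inr hne)
  rw [zero_mul] at h4
  refine h4.congr fun j => ?_
  rw [mul_assoc, ENNReal.inv_mul_cancel (by simp) hne, mul_one]

/-! ### Integration against independent variables -/

section indep

variable {Ω A B : Type*} [MeasurableSpace Ω] [MeasurableSpace A] [MeasurableSpace B]
  {P : Measure Ω} [IsProbabilityMeasure P] {μ : Measure B} {X : Ω → A} {W : Ω → B}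

lemma ProbabilityTheory.IndepFun.lintegral_comp_prodMk (h : IndepFun X W P) (hX : Measurable X)
    (hW : Measurable W) (hlaw : P.map W = μ) {F : A × B → ℝ≥0∞} (hF : Measurable F) :
    ∫⁻ ω, F (X ω, W ω) ∂P = ∫⁻ ω, ∫⁻ w, F (X ω, w) ∂μ ∂P := by
  have : IsProbabilityMeasure μ := hlaw ▸ Measure.isProbabilityMeasure_map hW.aemeasurable
  have h1 := (indepFun_iff_map_prod_eq_prod_map_map hX.aemeasurable hW.aemeasurable).1 h
  rw [hlaw] at h1
  rw [← lintegral_map hF (hX.prodMk hW), h1, lintegral_prod _ hF.aemeasurable,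
    lintegral_map (Measurable.lintegral_prod_right' hF) hX]

lemma ProbabilityTheory.IndepFun.integral_comp_prodMk (h : IndepFun X W P) (hX : Measurable X)
    (hW : Measurable W) (hlaw : P.map W = μ) {F : A × B → ℝ} (hF : Measurable F)
    (hi : Integrable (fun ω => F (X ω, W ω)) P) :
    ∫ ω, F (X ω, W ω) ∂P = ∫ ω, ∫ w, F (X ω, w) ∂μ ∂P := by
  have : IsProbabilityMeasure μ := hlaw ▸ Measure.isProbabilityMeasure_map hW.aemeasurable
  have : IsProbabilityMeasure (P.map X) := Measure.isProbabilityMeasure_map hX.aemeasurable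
  have h1 := (indepFun_iff_map_prod_eq_prod_map_map hX.aemeasurable hW.aemeasurable).1 h
  rw [hlaw] at h1
  have hi' : Integrable F ((P.map X).prod μ) := by
    rw [← h1, integrable_map_measure hF.aestronglyMeasurable (hX.prodMk hW).aemeasurable]
    exact hi
  rw [← integral_map (f := F) (hX.prodMk hW).aemeasurable hF.aestronglyMeasurable, h1,
    integral_prod _ hi', integral_map hX.aemeasurable]
  exact hF.stronglyMeasurable.integral_prod_right'.aestronglyMeasurable

end indep

/-! ### Stochastic descent along a varying objective -/

/-- A recursion `x_{k+1} = x_k - γ_k g_k(x_k, Y_k)` driven by independent noise, with unbiased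
directions `g_k` for the bounded fields `m_k`, along which the potentials `Φ_k` satisfy a descent
inequality with summable errors. -/
structure IsNoisyDescent {n : ℕ} {Ω W : Type*} [MeasurableSpace Ω] [MeasurableSpace W]
    (P : Measure Ω) (μ : ℕ → Measure W) (γ A e : ℕ → ℝ) (B C : ℝ)
    (g : ℕ → Rn n → W → Rn n) (m : ℕ → Rn n → Rn n) (Φ : ℕ → Rn n → ℝ)
    (Y : ℕ → Ω → W) (x : ℕ → Ω → Rn n) : Prop where
  measurable_Y : ∀ k, Measurable (Y k)
  map_Y : ∀ k, P.map (Y k) = μ k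
  indep : iIndepFun Y P
  measurable_g : ∀ k, Measurable fun q : Rn n × W => g k q.1 q.2
  measurable_m : ∀ k, Measurable (m k)
  norm_m_le : ∀ k y, ‖m k y‖ ≤ C
  integral_g : ∀ k y, ∫ w, g k y w ∂μ k = m k y
  B_nonneg : 0 ≤ B
  sq_g_le : ∀ k y, ∫⁻ w, ENNReal.ofReal (‖g k y w‖ ^ 2) ∂μ k ≤ ENNReal.ofReal B
  γ_pos : ∀ k, 0 < γ k
  A_nonneg : ∀ k, 0 ≤ A k
  e_nonneg : ∀ k, 0 ≤ e k
  summable_sq : Summable fun k => γ k ^ 2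
  summable_A : Summable fun k => A k * γ k ^ 2
  summable_e : Summable e
  descent : ∀ k y d, Φ (k + 1) (y + d) ≤ Φ k y + inner ℝ (m k y) d + A k * ‖d‖ ^ 2 + e k
  growth : ∃ a b : ℝ, 0 ≤ b ∧ ∀ k y, |Φ k y| ≤ a + b * ‖y‖
  init : ∃ x₀, ∀ ω, x 0 ω = x₀
  step : ∀ k ω, x (k + 1) ω = x k ω - γ k • g k (x k ω) (Y k ω)

namespace IsNoisyDescent

/-- The `σ`-algebra generated by the noise before time `K`. -/
abbrev past {Ω W : Type*} [MeasurableSpace W] (Y : ℕ → Ω → W) (K : ℕ) : MeasurableSpace Ω :=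
  ⨆ j ∈ Set.Iio K, MeasurableSpace.comap (Y j) inferInstance

lemma past_mono {Ω W : Type*} [MeasurableSpace W] (Y : ℕ → Ω → W)
    {K K' : ℕ} (h : K ≤ K') : past Y K ≤ past Y K' :=
  biSup_mono fun _ hj => lt_of_lt_of_le hj h

lemma measurable_past {Ω W : Type*} [MeasurableSpace W] (Y : ℕ → Ω → W) (K : ℕ) : Measurable[past Y (K + 1)] (Y K) :=
  measurable_iff_comap_le.2
    (le_biSup (fun j => MeasurableSpace.comap (Y j) inferInstance) (Nat.lt_succ_self K))

/-- The increment of the martingale part. -/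
def incr {n : ℕ} {Ω W : Type*} (γ : ℕ → ℝ) (g : ℕ → Rn n → W → Rn n)
    (m : ℕ → Rn n → Rn n) (Y : ℕ → Ω → W)
    (x : ℕ → Ω → Rn n) (k : ℕ) (ω : Ω) : ℝ :=
  γ k * inner ℝ (m k (x k ω)) (g k (x k ω) (Y k ω) - m k (x k ω))

/-- The martingale part of the descent inequality. -/
def noise {n : ℕ} {Ω W : Type*} (γ : ℕ → ℝ) (g : ℕ → Rn n → W → Rn n)
    (m : ℕ → Rn n → Rn n) (Y : ℕ → Ω → W)
    (x : ℕ → Ω → Rn n) (K : ℕ) (ω : Ω) : ℝ :=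
  ∑ k ∈ Finset.range K, incr γ g m Y x k ω

lemma incr_sq_le {n : ℕ} {Ω W : Type*} {γ : ℕ → ℝ} {C : ℝ} {g : ℕ → Rn n → W → Rn n}
    {m : ℕ → Rn n → Rn n} {Y : ℕ → Ω → W} {x : ℕ → Ω → Rn n} {k : ℕ} (hm : ∀ y, ‖m k y‖ ≤ C) (ω : Ω) :
    incr γ g m Y x k ω ^ 2
      ≤ γ k ^ 2 * (C ^ 2 * (2 * (‖g k (x k ω) (Y k ω)‖ ^ 2 + C ^ 2))) := by
  have hC := hm (x k ω)
  rw [incr, mul_pow]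
  refine mul_le_mul_of_nonneg_left ?_ (sq_nonneg _)
  have h1 := abs_real_inner_le_norm (m k (x k ω)) (g k (x k ω) (Y k ω) - m k (x k ω))
  have h2 := norm_sub_le (g k (x k ω) (Y k ω)) (m k (x k ω))
  rw [← sq_abs]
  have h0 := norm_nonneg (m k (x k ω))
  have h3 : ‖g k (x k ω) (Y k ω) - m k (x k ω)‖ ^ 2
      ≤ 2 * (‖g k (x k ω) (Y k ω)‖ ^ 2 + C ^ 2) := by
    have : ‖g k (x k ω) (Y k ω) - m k (x k ω)‖ ^ 2 ≤ (‖g k (x k ω) (Y k ω)‖ + C) ^ 2 := by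
      gcongr
      linarith
    nlinarith [sq_nonneg (‖g k (x k ω) (Y k ω)‖ - C)]
  calc _ ≤ (‖m k (x k ω)‖ * ‖g k (x k ω) (Y k ω) - m k (x k ω)‖) ^ 2 := by gcongr
    _ = ‖m k (x k ω)‖ ^ 2 * ‖g k (x k ω) (Y k ω) - m k (x k ω)‖ ^ 2 := mul_pow _ _ _
    _ ≤ _ := by gcongr

variable {n : ℕ} {Ω W : Type*} [MeasurableSpace Ω] [MeasurableSpace W]
  {P : Measure Ω} {μ : ℕ → Measure W} {γ A e : ℕ → ℝ} {B C : ℝ}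
  {g : ℕ → Rn n → W → Rn n} {m : ℕ → Rn n → Rn n} {Φ : ℕ → Rn n → ℝ}
  {Y : ℕ → Ω → W} {x : ℕ → Ω → Rn n}

/-- The iterate and the martingale are treated as one state, since orthogonality of the increments
requires `Y K` to be independent of the pair. -/
lemma measurable_state (h : IsNoisyDescent P μ γ A e B C g m Φ Y x) (K : ℕ) :
    Measurable[past Y K] fun ω => (x K ω, noise γ g m Y x K ω) := by
  induction K with
  | zero =>
    obtain ⟨x₀, hx₀⟩ := h.init
    simp only [hx₀, noise, Finset.range_zero, Finset.sum_empty]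
    exact measurable_const
  | succ K ih =>
    have ih' : Measurable[past Y (K + 1)] fun ω => (x K ω, noise γ g m Y x K ω) :=
      ih.mono (past_mono Y K.le_succ) le_rfl
    have hY := measurable_past Y K
    have hF : Measurable fun q : (Rn n × ℝ) × W => (q.1.1 - γ K • g K q.1.1 q.2,
        q.1.2 + γ K * inner ℝ (m K q.1.1) (g K q.1.1 q.2 - m K q.1.1)) := by
      have h1 : Measurable fun q : (Rn n × ℝ) × W => g K q.1.1 q.2 :=
        (h.measurable_g K).comp (measurable_fst.fst.prodMk measurable_snd)
      have h2 : Measurable fun q : (Rn n × ℝ) × W => m K q.1.1 :=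
        (h.measurable_m K).comp measurable_fst.fst
      exact (measurable_fst.fst.sub (h1.const_smul (γ K))).prodMk
        (measurable_fst.snd.add ((h2.inner (h1.sub h2)).const_mul _))
    have := hF.comp (@Measurable.prodMk Ω (past Y (K + 1)) _ _ _ _ _ _ ih' hY)
    refine (congrArg (@Measurable _ _ (past Y (K + 1)) _) ?_).mp this
    funext ω
    simp only [Function.comp_apply, h.step, noise, Finset.sum_range_succ, incr]

lemma past_le (h : IsNoisyDescent P μ γ A e B C g m Φ Y x) (K : ℕ) : past Y K ≤ ‹_› :=
  iSup₂_le fun j _ => (h.measurable_Y j).comap_le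

lemma indepFun_state (h : IsNoisyDescent P μ γ A e B C g m Φ Y x) (K : ℕ) :
    IndepFun (fun ω => (x K ω, noise γ g m Y x K ω)) (Y K) P := by
  rw [IndepFun_iff_Indep]
  have h1 := indep_iSup_of_disjoint (fun j => (h.measurable_Y j).comap_le) h.indep.iIndep
    (S := Set.Iio K) (T := {K}) (by simp)
  rw [iSup_singleton] at h1
  exact indep_of_indep_of_le_left h1 (measurable_iff_comap_le.1 (h.measurable_state K))

lemma measurable_x (h : IsNoisyDescent P μ γ A e B C g m Φ Y x) (K : ℕ) : Measurable (x K) :=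
  ((h.measurable_state K).mono (h.past_le K) le_rfl).fst

lemma measurable_noise (h : IsNoisyDescent P μ γ A e B C g m Φ Y x) (K : ℕ) :
    Measurable (noise γ g m Y x K) :=
  ((h.measurable_state K).mono (h.past_le K) le_rfl).snd

lemma measurable_dir (h : IsNoisyDescent P μ γ A e B C g m Φ Y x) (K : ℕ) :
    Measurable fun ω => g K (x K ω) (Y K ω) :=
  (h.measurable_g K).comp ((h.measurable_x K).prodMk (h.measurable_Y K))

lemma lintegral_dir_le [IsProbabilityMeasure P]
    (h : IsNoisyDescent P μ γ A e B C g m Φ Y x) (K : ℕ) :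
    ∫⁻ ω, ENNReal.ofReal (‖g K (x K ω) (Y K ω)‖ ^ 2) ∂P ≤ ENNReal.ofReal B := by
  have h1 : IndepFun (x K) (Y K) P := (h.indepFun_state K).comp measurable_fst measurable_id
  have h2 := h1.lintegral_comp_prodMk (h.measurable_x K) (h.measurable_Y K) (h.map_Y K)
    (F := fun q => ENNReal.ofReal (‖g K q.1 q.2‖ ^ 2))
    ((h.measurable_g K).norm.pow_const 2).ennreal_ofReal
  dsimp only at h2
  rw [h2]
  exact (lintegral_mono fun ω => h.sq_g_le K (x K ω)).trans (by simp)

lemma integrable_dir_sq [IsProbabilityMeasure P]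
    (h : IsNoisyDescent P μ γ A e B C g m Φ Y x) (K : ℕ) :
    Integrable (fun ω => ‖g K (x K ω) (Y K ω)‖ ^ 2) P := by
  refine ⟨((h.measurable_dir K).norm.pow_const 2).aestronglyMeasurable, ?_⟩
  rw [hasFiniteIntegral_iff_ofReal (ae_of_all _ fun ω => sq_nonneg _)]
  exact (h.lintegral_dir_le K).trans_lt ENNReal.ofReal_lt_top

lemma integral_dir_sq_le [IsProbabilityMeasure P]
    (h : IsNoisyDescent P μ γ A e B C g m Φ Y x) (K : ℕ) :
    ∫ ω, ‖g K (x K ω) (Y K ω)‖ ^ 2 ∂P ≤ B := by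
  rw [← ENNReal.ofReal_le_ofReal_iff h.B_nonneg,
    ofReal_integral_eq_lintegral_ofReal (h.integrable_dir_sq K) (ae_of_all _ fun ω => sq_nonneg _)]
  exact h.lintegral_dir_le K

lemma measurable_incr (h : IsNoisyDescent P μ γ A e B C g m Φ Y x) (K : ℕ) :
    Measurable (incr γ g m Y x K) := by
  have h1 := h.measurable_dir K
  have h2 := (h.measurable_m K).comp (h.measurable_x K)
  exact (h2.inner (h1.sub h2)).const_mul _

lemma memLp_incr [IsProbabilityMeasure P]
    (h : IsNoisyDescent P μ γ A e B C g m Φ Y x) (K : ℕ) :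
    MemLp (incr γ g m Y x K) 2 P := by
  rw [memLp_two_iff_integrable_sq (h.measurable_incr K).aestronglyMeasurable]
  refine ((((h.integrable_dir_sq K).add (integrable_const (C ^ 2))).const_mul 2).const_mul
    (C ^ 2) |>.const_mul (γ K ^ 2)).mono' ((h.measurable_incr K).pow_const 2).aestronglyMeasurable
      (ae_of_all _ fun ω => ?_)
  rw [Real.norm_of_nonneg (sq_nonneg _)]
  exact incr_sq_le (h.norm_m_le K) ω

lemma integral_incr_sq_le [IsProbabilityMeasure P]
    (h : IsNoisyDescent P μ γ A e B C g m Φ Y x) (K : ℕ) :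
    ∫ ω, incr γ g m Y x K ω ^ 2 ∂P ≤ γ K ^ 2 * (C ^ 2 * (2 * (B + C ^ 2))) := by
  have hi := (h.integrable_dir_sq K).add (integrable_const (C ^ 2))
  refine (integral_mono (memLp_two_iff_integrable_sq
    (h.measurable_incr K).aestronglyMeasurable |>.1 (h.memLp_incr K))
    ((hi.const_mul 2).const_mul (C ^ 2) |>.const_mul (γ K ^ 2))
    fun ω => incr_sq_le (h.norm_m_le K) ω).trans ?_
  rw [integral_const_mul, integral_const_mul, integral_const_mul,
    integral_add' (h.integrable_dir_sq K) (integrable_const _)]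
  simp only [integral_const, probReal_univ, smul_eq_mul, one_mul]
  have := h.integral_dir_sq_le K
  gcongr

lemma memLp_noise [IsProbabilityMeasure P]
    (h : IsNoisyDescent P μ γ A e B C g m Φ Y x) (K : ℕ) :
    MemLp (noise γ g m Y x K) 2 P :=
  memLp_finsetSum _ fun k _ => h.memLp_incr k

lemma integrable_g [IsProbabilityMeasure P]
    (h : IsNoisyDescent P μ γ A e B C g m Φ Y x) (k : ℕ) (y : Rn n) :
    Integrable (g k y) (μ k) := by
  have : IsProbabilityMeasure (μ k) :=
    h.map_Y k ▸ Measure.isProbabilityMeasure_map (h.measurable_Y k).aemeasurable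
  have hm : Measurable (g k y) := (h.measurable_g k).comp (measurable_const.prodMk measurable_id)
  refine MemLp.integrable one_le_two ((memLp_two_iff_integrable_sq_norm hm.aestronglyMeasurable).2
    ⟨(hm.norm.pow_const 2).aestronglyMeasurable, ?_⟩)
  rw [hasFiniteIntegral_iff_ofReal (ae_of_all _ fun ω => sq_nonneg _)]
  exact (h.sq_g_le k y).trans_lt ENNReal.ofReal_lt_top

/-- Independence allows integrating `Y K` out with the state frozen; unbiasedness of `g K` then
makes the inner integral zero. This replaces a conditional expectation. -/
lemma integral_noise_mul_incr [IsProbabilityMeasure P]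
    (h : IsNoisyDescent P μ γ A e B C g m Φ Y x) (K : ℕ) :
    ∫ ω, noise γ g m Y x K ω * incr γ g m Y x K ω ∂P = 0 := by
  have : IsProbabilityMeasure (μ K) :=
    h.map_Y K ▸ Measure.isProbabilityMeasure_map (h.measurable_Y K).aemeasurable
  have hF : Measurable fun q : (Rn n × ℝ) × W =>
      q.1.2 * (γ K * inner ℝ (m K q.1.1) (g K q.1.1 q.2 - m K q.1.1)) := by
    have h1 : Measurable fun q : (Rn n × ℝ) × W => g K q.1.1 q.2 :=
      (h.measurable_g K).comp (measurable_fst.fst.prodMk measurable_snd)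
    have h2 : Measurable fun q : (Rn n × ℝ) × W => m K q.1.1 :=
      (h.measurable_m K).comp measurable_fst.fst
    exact measurable_fst.snd.mul ((h2.inner (h1.sub h2)).const_mul _)
  have h1 := (h.indepFun_state K).integral_comp_prodMk
    ((h.measurable_state K).mono (h.past_le K) le_rfl) (h.measurable_Y K) (h.map_Y K) hF
    ((h.memLp_noise K).integrable_mul (h.memLp_incr K))
  refine h1.trans ((integral_congr_ae (ae_of_all _ fun ω => ?_)).trans (integral_zero _ _))
  have hg := h.integrable_g K (x K ω)
  simp only
  have hi := integral_inner (𝕜 := ℝ) (hg.sub (integrable_const (m K (x K ω)))) (m K (x K ω))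
  simp only [Pi.sub_apply] at hi
  rw [integral_const_mul, integral_const_mul, hi, integral_sub hg (integrable_const _), h.integral_g]
  simp

lemma integral_noise_sq_le [IsProbabilityMeasure P]
    (h : IsNoisyDescent P μ γ A e B C g m Φ Y x) (K : ℕ) :
    ∫ ω, noise γ g m Y x K ω ^ 2 ∂P
      ≤ (∑ k ∈ Finset.range K, γ k ^ 2) * (C ^ 2 * (2 * (B + C ^ 2))) := by
  induction K with
  | zero => simp [noise]
  | succ K ih =>
    have i1 := (memLp_two_iff_integrable_sq
      (h.measurable_noise K).aestronglyMeasurable).1 (h.memLp_noise K)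
    have i2 := (memLp_two_iff_integrable_sq
      (h.measurable_incr K).aestronglyMeasurable).1 (h.memLp_incr K)
    have i3 : Integrable (fun ω => noise γ g m Y x K ω * incr γ g m Y x K ω) P :=
      (h.memLp_noise K).integrable_mul (h.memLp_incr K)
    have heq : ∀ ω, noise γ g m Y x (K + 1) ω ^ 2 = noise γ g m Y x K ω ^ 2
        + 2 * (noise γ g m Y x K ω * incr γ g m Y x K ω) + incr γ g m Y x K ω ^ 2 := fun ω => by
      rw [noise, Finset.sum_range_succ, ← noise]
      ring
    simp_rw [heq]
    rw [integral_add (by exact i1.add (i3.const_mul 2)) i2, integral_add i1 (i3.const_mul 2),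
      integral_const_mul, h.integral_noise_mul_incr, Finset.sum_range_succ, add_mul]
    linarith [h.integral_incr_sq_le K]

/-- Telescoping of the descent inequality at `d = -γ_k g_k`, whose linear term is `-γ_k ‖m_k‖²`
minus the martingale increment. -/
lemma sum_norm_sq_le (h : IsNoisyDescent P μ γ A e B C g m Φ Y x) (K : ℕ) (ω : Ω) :
    ∑ k ∈ Finset.range K, γ k * ‖m k (x k ω)‖ ^ 2 ≤ Φ 0 (x 0 ω) - Φ K (x K ω)
      - noise γ g m Y x K ω
      + ∑ k ∈ Finset.range K, A k * γ k ^ 2 * ‖g k (x k ω) (Y k ω)‖ ^ 2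
      + ∑ k ∈ Finset.range K, e k := by
  induction K with
  | zero => simp [noise]
  | succ K ih =>
    have h1 := h.descent K (x K ω) (-(γ K • g K (x K ω) (Y K ω)))
    rw [← sub_eq_add_neg, ← h.step, inner_neg_right, inner_smul_right, norm_neg, norm_smul,
      mul_pow, Real.norm_eq_abs, sq_abs] at h1
    simp only [noise, Finset.sum_range_succ] at ih ⊢
    have h2 : incr γ g m Y x K ω = γ K * inner ℝ (m K (x K ω)) (g K (x K ω) (Y K ω))
        - γ K * ‖m K (x K ω)‖ ^ 2 := by
      rw [incr, inner_sub_right, real_inner_self_eq_norm_sq]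
      ring
    linarith

/-- The nonnegative remainder in the descent inequality. -/
def remainder (γ A : ℕ → ℝ) (g : ℕ → Rn n → W → Rn n) (m : ℕ → Rn n → Rn n) (Y : ℕ → Ω → W)
    (x : ℕ → Ω → Rn n) (K : ℕ) (ω : Ω) : ℝ :=
  noise γ g m Y x K ω ^ 2
    + ∑ k ∈ Finset.range K, A k * γ k ^ 2 * ‖g k (x k ω) (Y k ω)‖ ^ 2

lemma lintegral_remainder_le [IsProbabilityMeasure P]
    (h : IsNoisyDescent P μ γ A e B C g m Φ Y x) (K : ℕ) :
    ∫⁻ ω, ENNReal.ofReal (remainder γ A g m Y x K ω) ∂P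
      ≤ ENNReal.ofReal ((∑' k, γ k ^ 2) * (C ^ 2 * (2 * (B + C ^ 2)))
        + (∑' k, A k * γ k ^ 2) * B) := by
  have i1 := (memLp_two_iff_integrable_sq
      (h.measurable_noise K).aestronglyMeasurable).1 (h.memLp_noise K)
  have i2 : ∀ k ∈ Finset.range K, Integrable
      (fun ω => A k * γ k ^ 2 * ‖g k (x k ω) (Y k ω)‖ ^ 2) P := fun k _ =>
    (h.integrable_dir_sq k).const_mul _
  have hA := h.A_nonneg
  have hB := h.B_nonneg
  rw [← ofReal_integral_eq_lintegral_ofReal (f := remainder γ A g m Y x K)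
    (i1.add (integrable_finsetSum _ i2)) (ae_of_all _ fun ω => by
      refine add_nonneg (sq_nonneg _) (Finset.sum_nonneg fun k _ => ?_)
      have := hA k
      positivity)]
  refine ENNReal.ofReal_le_ofReal ?_
  rw [show (fun ω => remainder γ A g m Y x K ω) = fun ω => noise γ g m Y x K ω ^ 2
    + ∑ k ∈ Finset.range K, A k * γ k ^ 2 * ‖g k (x k ω) (Y k ω)‖ ^ 2 from rfl,
    integral_add i1 (integrable_finsetSum _ i2), integral_finsetSum _ i2]
  refine add_le_add ((h.integral_noise_sq_le K).trans ?_) ?_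
  · gcongr
    exact h.summable_sq.sum_le_tsum _ fun k _ => sq_nonneg _
  · calc _ ≤ ∑ k ∈ Finset.range K, A k * γ k ^ 2 * B := by
          refine Finset.sum_le_sum fun k _ => ?_
          rw [integral_const_mul]
          exact mul_le_mul_of_nonneg_left (h.integral_dir_sq_le k)
            (mul_nonneg (hA k) (sq_nonneg _))
      _ ≤ _ := by
          rw [← Finset.sum_mul]
          gcongr
          exact h.summable_A.sum_le_tsum _ fun k _ => mul_nonneg (hA k) (sq_nonneg _)

lemma measurable_remainder (h : IsNoisyDescent P μ γ A e B C g m Φ Y x) (K : ℕ) :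
    Measurable (remainder γ A g m Y x K) :=
  ((h.measurable_noise K).pow_const 2).add
    (Finset.measurable_fun_sum _ fun k _ => ((h.measurable_dir k).norm.pow_const 2).const_mul _)

/-- If some subsequence of the iterates converges almost surely, the weighted sum of the squared
norms of the mean directions is almost surely finite. -/
theorem ae_tsum_ne_top [IsProbabilityMeasure P]
    (h : IsNoisyDescent P μ γ A e B C g m Φ Y x) {a : ℕ → ℕ}
    (ha : StrictMono a)
    (hconv : ∀ᵐ ω ∂P, ∃ l : Rn n, Tendsto (fun j => x (a j) ω) atTop (𝓝 l)) :
    ∀ᵐ ω ∂P, ∑' k, ENNReal.ofReal (γ k) * ENNReal.ofReal (‖m k (x k ω)‖ ^ 2) ≠ ∞ := by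
  obtain ⟨x₀, hx₀⟩ := h.init
  obtain ⟨α, β, hβ, hΦ⟩ := h.growth
  have hmeas : ∀ j, Measurable fun ω => ENNReal.ofReal (remainder γ A g m Y x (a j) ω) :=
    fun j => (h.measurable_remainder (a j)).ennreal_ofReal
  -- The mean remainder is bounded uniformly in time, so Fatou gives an almost surely finite liminf
  -- and hence a finite `M` exceeding the remainder infinitely often. This suffices because the
  -- partial sums to be bounded are monotone.
  have hfatou : ∫⁻ ω, liminf (fun j => ENNReal.ofReal (remainder γ A g m Y x (a j) ω)) atTop ∂P
      ≠ ∞ := by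
    refine ne_top_of_le_ne_top (ENNReal.ofReal_ne_top
      (r := (∑' k, γ k ^ 2) * (C ^ 2 * (2 * (B + C ^ 2))) + (∑' k, A k * γ k ^ 2) * B)) ((lintegral_liminf_le hmeas).trans
      ((liminf_le_liminf (Eventually.of_forall fun j => h.lintegral_remainder_le (a j))).trans ?_))
    exact (liminf_const _).le
  have hlim := ae_lt_top (Measurable.liminf hmeas) hfatou
  filter_upwards [hlim, hconv] with ω h1 ⟨l, hl⟩
  obtain ⟨M, hM⟩ := ENNReal.lt_iff_exists_nnreal_btwn.1 h1
  have hfr := frequently_lt_of_liminf_lt (by isBoundedDefault) hM.1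
  obtain ⟨R, hR⟩ := (hl.norm.bddAbove_range)
  have hbound : ∀ K, ∑ k ∈ Finset.range K, γ k * ‖m k (x k ω)‖ ^ 2
      ≤ Φ 0 x₀ + (α + β * R) + 1 + M + ∑' k, e k := by
    intro K
    obtain ⟨j, hjK, hj⟩ := (frequently_atTop.1 hfr) K
    have e1 : ∑ k ∈ Finset.range K, γ k * ‖m k (x k ω)‖ ^ 2
        ≤ ∑ k ∈ Finset.range (a j), γ k * ‖m k (x k ω)‖ ^ 2 :=
      Finset.sum_le_sum_of_subset_of_nonneg
        (Finset.range_mono (hjK.trans (ha.id_le j)))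
        fun k _ _ => mul_nonneg (h.γ_pos k).le (sq_nonneg _)
    have e2 := h.sum_norm_sq_le (a j) ω
    rw [hx₀] at e2
    have e3 : remainder γ A g m Y x (a j) ω ≤ M := by
      rw [← ENNReal.ofReal_coe_nnreal] at hj
      exact (ENNReal.ofReal_le_ofReal_iff M.2).1 hj.le
    rw [remainder] at e3
    have e4 := (abs_le.1 (hΦ (a j) (x (a j) ω))).1
    have e5 : ‖x (a j) ω‖ ≤ R := hR ⟨j, rfl⟩
    have e6 := mul_le_mul_of_nonneg_left e5 hβ
    have e7 := h.summable_e.sum_le_tsum (Finset.range (a j)) fun k _ => h.e_nonneg k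
    -- The remainder contains the square of the noise `N`; `-N ≤ N² + 1` is the source of the `1` in
    -- the bound.
    nlinarith [sq_nonneg (noise γ g m Y x (a j) ω + 1)]
  refine ne_top_of_le_ne_top (ENNReal.ofReal_ne_top
    (r := Φ 0 x₀ + (α + β * R) + 1 + M + ∑' k, e k)) (ENNReal.tsum_le_of_sum_range_le fun K => ?_)
  simp_rw [← ENNReal.ofReal_mul (h.γ_pos _).le]
  rw [← ENNReal.ofReal_sum_of_nonneg fun k _ => mul_nonneg (h.γ_pos k).le (sq_nonneg _)]
  exact ENNReal.ofReal_le_ofReal (hbound K)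

/-- Under the same assumptions, the mean directions tend to `0` almost surely along some
subsequence of deterministic indices. -/
theorem exists_strictMono_ae_tendsto [IsProbabilityMeasure P]
    (h : IsNoisyDescent P μ γ A e B C g m Φ Y x)
    (hγ : Tendsto (fun K => ∑ k ∈ Finset.range K, γ k) atTop atTop) {a : ℕ → ℕ}
    (ha : StrictMono a)
    (hconv : ∀ᵐ ω ∂P, ∃ l : Rn n, Tendsto (fun j => x (a j) ω) atTop (𝓝 l)) :
    ∃ b : ℕ → ℕ, StrictMono b ∧
      ∀ᵐ ω ∂P, Tendsto (fun j => m (b j) (x (b j) ω)) atTop (𝓝 0) := by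
  obtain ⟨b, hb, hlim⟩ := exists_strictMono_ae_tendsto_zero h.γ_pos hγ
    (φ := fun k ω => ENNReal.ofReal (‖m k (x k ω)‖ ^ 2))
    (fun k => (((h.measurable_m k).comp (h.measurable_x k)).norm.pow_const 2).ennreal_ofReal)
    (h.ae_tsum_ne_top ha hconv)
  refine ⟨b, hb, hlim.mono fun ω hω => ?_⟩
  have h1 := (ENNReal.continuousAt_toReal ENNReal.zero_ne_top).tendsto.comp hω
  simp only [Function.comp_def, ENNReal.toReal_ofReal (sq_nonneg _), ENNReal.toReal_zero] at h1
  rw [tendsto_zero_iff_norm_tendsto_zero]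
  have h2 := (Real.continuous_sqrt.tendsto 0).comp h1
  simpa [Function.comp_def, Real.sqrt_sq (norm_nonneg _)] using h2

end IsNoisyDescent

/-! ### `L²` norms as lower integrals of squares -/

lemma lintegral_ofReal_sq_eq {α : Type*} [MeasurableSpace α] (μ : Measure α) (h : α → ℝ) :
    ∫⁻ s, ENNReal.ofReal (h s ^ 2) ∂μ = eLpNorm h 2 μ ^ 2 := by
  have h1 := eLpNorm_nnreal_pow_eq_lintegral (f := h) (μ := μ) (p := 2) two_ne_zero
  simp only [NNReal.coe_ofNat, ENNReal.rpow_two, ENNReal.coe_ofNat] at h1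
  rw [h1]
  refine lintegral_congr fun s => ?_
  rw [Real.enorm_eq_ofReal_abs, ← ENNReal.ofReal_pow (abs_nonneg _), sq_abs]

lemma eLpNorm_two_le_iff {α : Type*} [MeasurableSpace α] (μ : Measure α) (h : α → ℝ) {c : ℝ}
    (hc : 0 ≤ c) : eLpNorm h 2 μ ≤ ENNReal.ofReal c
      ↔ ∫⁻ s, ENNReal.ofReal (h s ^ 2) ∂μ ≤ ENNReal.ofReal (c ^ 2) := by
  rw [lintegral_ofReal_sq_eq, ENNReal.ofReal_pow hc]
  exact (ENNReal.pow_le_pow_left_iff two_ne_zero).symm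

/-! ### Moments of the estimator -/

namespace StandardModel

variable {n : ℕ} {S : Type*} [MeasurableSpace S] {ν : Measure S} {F : Rn n → S → ℝ} {L₀ : ℝ≥0}

lemma lipschitzWith_integral (h : StandardModel ν F L₀) :
    LipschitzWith L₀ fun y => ∫ s, F y s ∂ν := by
  have := h.isProbability
  refine LipschitzWith.of_dist_le_mul fun x y => ?_
  rw [dist_eq_norm, dist_eq_norm, ← integral_sub (h.integrable x) (h.integrable y)]
  have h1 : ‖∫ s, (F x s - F y s) ∂ν‖ₑ ≤ ENNReal.ofReal ((L₀ : ℝ) * ‖x - y‖) := by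
    refine (enorm_integral_le_lintegral_enorm _).trans ?_
    rw [← eLpNorm_one_eq_lintegral_enorm]
    exact (eLpNorm_le_eLpNorm_of_exponent_le one_le_two
      ((h.integrable x).sub (h.integrable y)).aestronglyMeasurable).trans (h.lipschitz x y)
  rw [← ofReal_norm, ENNReal.ofReal_le_ofReal_iff (by positivity)] at h1
  exact h1

lemma lintegral_sub_sq_le (h : StandardModel ν F L₀) (x y : Rn n) :
    ∫⁻ s, ENNReal.ofReal ((F x s - F y s) ^ 2) ∂ν
      ≤ ENNReal.ofReal (((L₀ : ℝ) * ‖x - y‖) ^ 2) :=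
  (eLpNorm_two_le_iff ν _ (by positivity)).1 (h.lipschitz x y)

lemma measurable_esGs (h : StandardModel ν F L₀) (η : ℝ) (i : Fin n) :
    Measurable fun q : Rn n × ℝ × Rn n × S =>
      esGs η (fun u => F u q.2.2.2) q.1 q.2.1 q.2.2.1 i := by
  have hG : Measurable fun q : Rn n × Rn n × ℝ × Rn n × S => F q.1 q.2.2.2.2 :=
    h.measurable.comp (measurable_fst.prodMk measurable_snd.snd.snd.snd)
  exact measurable_esGs_apply (G := fun (q : Rn n × ℝ × Rn n × S) u => F u q.2.2.2) hG η
    measurable_fst measurable_snd.fst measurable_snd.snd.fst i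

lemma measurable_esGs_right (h : StandardModel ν F L₀) (η : ℝ) (x : Rn n) (i : Fin n) :
    Measurable fun w : ℝ × Rn n × S => esGs η (fun u => F u w.2.2) x w.1 w.2.1 i :=
  (h.measurable_esGs η i).comp (measurable_const.prodMk measurable_id)

/-- The sample is integrated first, because the `L²` Lipschitz bound concerns two fixed points.
These are `2 η √(2v)` apart, so the factor `η²` cancels the squared prefactor and the bound is
uniform in `η` and `x`. -/
lemma lintegral_esGs_sq_le (h : StandardModel ν F L₀) {η : ℝ} (hη : 0 < η) (x : Rn n)
    (i : Fin n) :
    ∫⁻ w, ENNReal.ofReal (esGs η (fun u => F u w.2.2) x w.1 w.2.1 i ^ 2)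
        ∂(expMeasure 1).prod ((isoGaussian n η).prod ν)
      ≤ ENNReal.ofReal (8 * L₀ ^ 2) * ∫⁻ v, ENNReal.ofReal v ∂expMeasure 1 := by
  have := h.isProbability
  set c : ℝ := 1 / (η * Real.sqrt (2 * Real.pi)) with hc
  have hc0 : 0 ≤ c := by positivity
  have hcη : c * η ≤ 1 := by
    have := mul_le_mul_of_nonneg_right (one_div_mul_sqrt_two_pi_le hη) hη.le
    rwa [one_div_mul_cancel hη.ne'] at this
  have hinner : ∀ (v : ℝ) (z : Rn n), ∫⁻ s, ENNReal.ofReal (esGs η (fun u => F u s) x v z i ^ 2) ∂ν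
      ≤ ENNReal.ofReal (4 * c ^ 2 * L₀ ^ 2) * ENNReal.ofReal (halfWidth η v ^ 2) := by
    intro v z
    simp only [esGs_apply, mul_pow, ← hc, ENNReal.ofReal_mul (sq_nonneg c)]
    rw [lintegral_const_mul' _ _ ENNReal.ofReal_ne_top]
    refine (mul_le_mul_right (h.lintegral_sub_sq_le _ _) _).trans_eq ?_
    rw [norm_shiftedPoint_sub_shiftedPoint, ← ENNReal.ofReal_mul (sq_nonneg c),
      ← ENNReal.ofReal_mul (by positivity), sub_neg_eq_add, mul_pow, sq_abs]
    congr 1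
    ring
  have hm := h.measurable_esGs_right η x i
  rw [lintegral_prod _ (hm.pow_const 2).ennreal_ofReal.aemeasurable]
  calc _ ≤ ∫⁻ v, ENNReal.ofReal (4 * c ^ 2 * L₀ ^ 2) * ENNReal.ofReal (halfWidth η v ^ 2)
        ∂expMeasure 1 := by
        refine lintegral_mono fun v => ?_
        have hm' : Measurable fun w : Rn n × S =>
            ENNReal.ofReal (esGs η (fun u => F u w.2) x v w.1 i ^ 2) :=
          ((hm.comp (measurable_const.prodMk measurable_id)).pow_const 2).ennreal_ofReal
        dsimp only
        rw [lintegral_prod _ hm'.aemeasurable]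
        exact (lintegral_mono fun z => hinner v z).trans (by simp)
    _ = ENNReal.ofReal (8 * L₀ ^ 2 * (c * η) ^ 2) * ∫⁻ v, ENNReal.ofReal v ∂expMeasure 1 := by
        rw [lintegral_const_mul' _ _ ENNReal.ofReal_ne_top, lintegral_halfWidth_sq, ← mul_assoc,
          ← ENNReal.ofReal_mul (by positivity)]
        congr 2
        ring
    _ ≤ _ := by
        gcongr ENNReal.ofReal ?_ * _
        exact mul_le_of_le_one_right (by positivity) (pow_le_one₀ (by positivity) hcη)

lemma integrable_esGs (h : StandardModel ν F L₀) {η : ℝ} (hη : 0 < η) (x : Rn n) (i : Fin n) :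
    Integrable (fun w : ℝ × Rn n × S => esGs η (fun u => F u w.2.2) x w.1 w.2.1 i)
      ((expMeasure 1).prod ((isoGaussian n η).prod ν)) := by
  have := h.isProbability
  have hm := h.measurable_esGs_right η x i
  refine MemLp.integrable one_le_two ((memLp_two_iff_integrable_sq hm.aestronglyMeasurable).2
    ⟨(hm.pow_const 2).aestronglyMeasurable, ?_⟩)
  rw [hasFiniteIntegral_iff_ofReal (ae_of_all _ fun ω => sq_nonneg _)]
  exact (h.lintegral_esGs_sq_le hη x i).trans_lt
    (ENNReal.mul_lt_top ENNReal.ofReal_lt_top lintegral_ofReal_expMeasure_one_lt_top)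

lemma integral_esGs (h : StandardModel ν F L₀) {η : ℝ} (hη : 0 < η) (x : Rn n) (i : Fin n) :
    ∫ w, esGs η (fun u => F u w.2.2) x w.1 w.2.1 i
        ∂(expMeasure 1).prod ((isoGaussian n η).prod ν)
      = esGsMean η (fun y => ∫ s, F y s ∂ν) x i := by
  have := h.isProbability
  have hassoc := measurePreserving_prodAssoc (expMeasure 1) (isoGaussian n η) ν
  have hi := h.integrable_esGs hη x i
  rw [← hassoc.integrable_comp_emb (MeasurableEquiv.measurableEmbedding _)] at hi
  rw [← hassoc.integral_comp (MeasurableEquiv.measurableEmbedding _), esGsMean_apply]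
  refine (integral_prod _ hi).trans (integral_congr_ae (ae_of_all _ fun q => ?_))
  simp only [esGs_apply]
  change ∫ s, 1 / (η * Real.sqrt (2 * Real.pi)) *
    (F (shiftedPoint x q.2 i (halfWidth η q.1)) s - F (shiftedPoint x q.2 i (-halfWidth η q.1)) s)
      ∂ν = _
  rw [integral_const_mul, integral_sub (h.integrable _) (h.integrable _)]

end StandardModel

lemma norm_sq_eq_sum {n : ℕ} (y : Rn n) : ‖y‖ ^ 2 = ∑ i, y i ^ 2 :=
  EuclideanSpace.real_norm_sq_eq y

/-! ### The iteration as a noisy descent -/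

lemma IsStepChoice.summable_sq {γ η : ℕ → ℝ} (h : IsStepChoice γ η) :
    Summable fun k => γ k ^ 2 := by
  obtain ⟨M, hM⟩ := h.η_tendsto.bddAbove_range
  refine Summable.of_nonneg_of_le (fun k => sq_nonneg _) (fun k => ?_)
    (h.summable_sq_div.mul_right M)
  have h1 : η k ≤ M := hM ⟨k, rfl⟩
  have h2 := h.η_pos k
  calc γ k ^ 2 = γ k ^ 2 / η k * η k := by field_simp
    _ ≤ _ := by gcongr

lemma exists_abs_smoothing_le {n : ℕ} {L : ℝ≥0} {f : Rn n → ℝ} (hL : LipschitzWith L f)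
    {η : ℕ → ℝ} (hη : ∀ k, 0 < η k) (hη0 : Tendsto η atTop (𝓝 0)) :
    ∃ a b : ℝ, 0 ≤ b ∧ ∀ k y, |smoothing (η k) f y| ≤ a + b * ‖y‖ := by
  obtain ⟨M, hM⟩ := hη0.bddAbove_range
  refine ⟨|smoothing 0 f 0| + L * M * ∫ z, ‖z‖ ∂stdGaussian (Rn n), L, L.2, fun k y => ?_⟩
  have h1 := abs_smoothing_sub_le hL (η k) y 0
  have h2 := abs_smoothing_sub_smoothing_le hL (η k) 0 0
  have h3 : η k ≤ M := hM ⟨k, rfl⟩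
  rw [sub_zero] at h1 h2
  rw [abs_of_pos (hη k)] at h2
  have h4 : L * η k * ∫ z, ‖z‖ ∂stdGaussian (Rn n) ≤ L * M * ∫ z, ‖z‖ ∂stdGaussian (Rn n) := by
    have : 0 ≤ ∫ z, ‖z‖ ∂stdGaussian (Rn n) := integral_nonneg fun z => norm_nonneg z
    gcongr
  have h5 := abs_sub_abs_le_abs_sub (smoothing (η k) f y) (smoothing (η k) f 0)
  have h6 := abs_sub_abs_le_abs_sub (smoothing (η k) f 0) (smoothing 0 f 0)
  linarith

theorem StandardModel.isNoisyDescent {n : ℕ} {Ω S : Type*} [MeasurableSpace Ω]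
    [MeasurableSpace S] {P : Measure Ω} {x₀ : Rn n} {γ η : ℕ → ℝ} {ν : Measure S}
    {F : Rn n → S → ℝ} {L₀ : ℝ≥0} {V : ℕ → Ω → ℝ} {Z : ℕ → Ω → Rn n} {ξ : ℕ → Ω → S}
    {x : ℕ → Ω → Rn n} (h : StandardModel ν F L₀) (hγη : IsStepChoice γ η)
    (hs : IsSampling P η ν V Z ξ)
    (hx : IsIteration x₀ γ η (fun k ω y => F y (ξ k ω)) V Z x) :
    IsNoisyDescent P (fun k => (expMeasure 1).prod ((isoGaussian n (η k)).prod ν)) γ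
      (fun k => 4 * n * L₀ / η k)
      (fun k => L₀ * |η (k + 1) - η k| * ∫ z, ‖z‖ ∂stdGaussian (Rn n))
      (n * (8 * L₀ ^ 2 * (∫⁻ v, ENNReal.ofReal v ∂expMeasure 1).toReal))
      (n * (2 * L₀ * ∫ v, halfWidth 1 v ∂expMeasure 1))
      (fun k y w => esGs (η k) (fun u => F u w.2.2) y w.1 w.2.1)
      (fun k => esGsMean (η k) fun y => ∫ s, F y s ∂ν)
      (fun k => smoothing (η k) fun y => ∫ s, F y s ∂ν)
      (fun k ω => (V k ω, Z k ω, ξ k ω)) x where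
  measurable_Y k := (hs.measurable_V k).prodMk ((hs.measurable_Z k).prodMk (hs.measurable_ξ k))
  map_Y k := (hs.hasLaw k).map_eq
  indep := hs.indep
  measurable_g k := (WithLp.measurable_toLp 2 _).comp
    (measurable_pi_iff.2 fun i => h.measurable_esGs (η k) i)
  measurable_m k := (continuous_esGsMean h.lipschitzWith_integral (hγη.η_pos k).le).measurable
  norm_m_le k y := norm_esGsMean_le h.lipschitzWith_integral (hγη.η_pos k) y
  integral_g k y := by
    ext i
    rw [eval_integral_piLp fun i => h.integrable_esGs (hγη.η_pos k) y i]
    exact h.integral_esGs (hγη.η_pos k) y i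
  B_nonneg := by positivity
  sq_g_le k y := by
    simp_rw [norm_sq_eq_sum]
    simp_rw [ENNReal.ofReal_sum_of_nonneg fun i _ => sq_nonneg _]
    rw [lintegral_finsetSum _ fun i _ =>
      ((h.measurable_esGs_right (η k) y i).pow_const 2).ennreal_ofReal]
    refine (Finset.sum_le_sum fun i _ => h.lintegral_esGs_sq_le (hγη.η_pos k) y i).trans_eq ?_
    rw [Finset.sum_const, Finset.card_univ, Fintype.card_fin, nsmul_eq_mul,
      ← ENNReal.ofReal_natCast, ENNReal.ofReal_mul (Nat.cast_nonneg n),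
      ENNReal.ofReal_mul (p := 8 * (L₀ : ℝ) ^ 2) (by positivity),
      ENNReal.ofReal_toReal lintegral_ofReal_expMeasure_one_lt_top.ne]
  γ_pos := hγη.γ_pos
  A_nonneg k := by
    have := hγη.η_pos k
    positivity
  e_nonneg k := mul_nonneg (by positivity) (integral_nonneg fun z => norm_nonneg z)
  summable_sq := hγη.summable_sq
  summable_A := by
    refine (hγη.summable_sq_div.mul_left (4 * n * L₀ : ℝ)).congr fun k => ?_
    ring
  summable_e := (hγη.summable_diff.mul_left _).mul_right _
  descent k y d := by
    have h1 := (abs_le.1 (abs_smoothing_sub_smoothing_le h.lipschitzWith_integral (η (k + 1))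
      (η k) (y + d))).2
    have h2 := (abs_le.1 (abs_smoothing_add_sub_inner_le h.lipschitzWith_integral (hγη.η_pos k)
      y d)).2
    linarith
  growth := exists_abs_smoothing_le h.lipschitzWith_integral hγη.η_pos hγη.η_tendsto
  init := ⟨x₀, hx.init⟩
  step := hx.step

/-- Subsequential almost sure Clarke stationarity for an `L²`-Lipschitz random function. -/
theorem StandardModel.hasStationaryClusterPoint {n : ℕ} {Ω S : Type*} [MeasurableSpace Ω]
    [MeasurableSpace S] {P : Measure Ω} [IsProbabilityMeasure P] {x₀ : Rn n} {γ η : ℕ → ℝ}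
    {ν : Measure S} {F : Rn n → S → ℝ} {L₀ : ℝ≥0} {V : ℕ → Ω → ℝ} {Z : ℕ → Ω → Rn n}
    {ξ : ℕ → Ω → S} {x : ℕ → Ω → Rn n} (h : StandardModel ν F L₀) (hγη : IsStepChoice γ η)
    (hconv : HasASConvergentSubsubsequences P x) (hs : IsSampling P η ν V Z ξ)
    (hx : IsIteration x₀ γ η (fun k ω y => F y (ξ k ω)) V Z x) :
    HasStationaryClusterPoint P x (fun y => ∫ s, F y s ∂ν) := by
  have hd := h.isNoisyDescent hγη hs hx
  -- Compactness is used twice: here only to bound the iterates infinitely often, and below to make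
  -- them converge along the indices where the gradients vanish.
  obtain ⟨a, ha, hlim⟩ := hconv id strictMono_id
  obtain ⟨b, hb, hgrad⟩ := hd.exists_strictMono_ae_tendsto hγη.sum_γ ha hlim
  obtain ⟨c, hc, hlim'⟩ := hconv b hb
  obtain ⟨xs, hxs, hxslim⟩ := measurable_limit_of_tendsto_metrizable_ae
    (fun j => (hd.measurable_x (b (c j))).aemeasurable) hlim'
  refine ⟨xs, hxs, ⟨b ∘ c, hb.comp hc, hxslim⟩, ?_⟩
  filter_upwards [hxslim, hgrad] with ω h1 h2
  exact zero_mem_clarkeSubdifferential h.lipschitzWith_integral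
    (fun j => hγη.η_pos (b (c j))) (hγη.η_tendsto.comp (hb.comp hc).tendsto_atTop) h1
    (h2.comp hc.tendsto_atTop)

/-! ### Unknown densities -/

section field

variable {n : ℕ} {S E : Type*} [MeasurableSpace S] [MeasurableSpace E] {ν : Measure S}
  {field : Rn n → S → E} {D : Rn n → Measure E} {F : Rn n → E → ℝ} {L₀ : ℝ≥0}

lemma RandomFieldModel.measurable_apply (h : RandomFieldModel ν field D F L₀) (x : Rn n) :
    Measurable (F x) :=
  h.measurable_F.comp (measurable_const.prodMk measurable_id)

lemma RandomFieldModel.standardModel (h : RandomFieldModel ν field D F L₀) :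
    StandardModel ν (fun y s => F y (field y s)) L₀ where
  isProbability := h.isProbability
  measurable := h.measurable_F.comp (measurable_fst.prodMk h.measurable_field)
  integrable x := by
    have h1 := h.integrable x
    rw [← (h.marginal x).map_eq, integrable_map_measure
      (h.measurable_apply x).aestronglyMeasurable (h.marginal x).aemeasurable] at h1
    exact h1
  lipschitz := h.lipschitz

lemma RandomFieldModel.integral_eq (h : RandomFieldModel ν field D F L₀) (y : Rn n) :
    ∫ e, F y e ∂(D y) = ∫ s, F y (field y s) ∂ν :=
  ((h.marginal y).integral_comp (h.measurable_apply y).aestronglyMeasurable).symm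

end field

/-! ### Densities and the Kullback-Leibler divergence -/

/-- For `a ≥ b > 0` the symmetric KL integrand is `(a - b) log (a / b)`, and `a log (a / b) ≥ a -
b`. -/
lemma sq_sub_le_max_mul_klFun {a b : ℝ} (ha : 0 ≤ a) (hb : 0 ≤ b) :
    (a - b) ^ 2 ≤ max a b * (b * InformationTheory.klFun (a / b)
      + a * InformationTheory.klFun (b / a)) := by
  wlog hab : b ≤ a generalizing a b
  · have := this hb ha (le_of_not_ge hab)
    rw [max_comm, add_comm (b * _)]
    linarith
  rw [max_eq_left hab]
  -- At `b = 0` the convention `a / 0 = 0` is harmless, as that term is multiplied by `b`; since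
  -- `klFun 0 = 1`, equality holds.
  rcases hb.eq_or_lt with rfl | hb
  · simp [sq, InformationTheory.klFun_zero]
  have ha : 0 < a := hb.trans_le hab
  have h1 : b * InformationTheory.klFun (a / b) + a * InformationTheory.klFun (b / a)
      = (a - b) * -Real.log (b / a) := by
    rw [InformationTheory.klFun_apply, InformationTheory.klFun_apply, Real.log_div ha.ne' hb.ne',
      Real.log_div hb.ne' ha.ne']
    field_simp
    ring
  have h2 : a - b ≤ a * -Real.log (b / a) := by
    have := mul_le_mul_of_nonneg_left (Real.log_le_sub_one_of_pos (div_pos hb ha)) ha.le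
    rw [mul_sub, mul_div_cancel₀ _ ha.ne'] at this
    linarith
  rw [h1]
  nlinarith [mul_le_mul_of_nonneg_left h2 (sub_nonneg.2 hab)]

section density

variable {S : Type*} [MeasurableSpace S] {lam : Measure S} {p q : S → ℝ}

lemma ae_eq_zero_of_densityMeasure_ac (hp : Measurable p) (hq : Measurable q) (hp0 : ∀ s, 0 ≤ p s)
    (hac : densityMeasure lam p ≪ densityMeasure lam q) : ∀ᵐ s ∂lam, q s = 0 → p s = 0 := by
  have h1 : densityMeasure lam q {s | q s = 0} = 0 := by
    rw [densityMeasure, withDensity_apply_eq_zero hq.ennreal_ofReal]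
    convert! measure_empty (μ := lam)
    ext s
    simpa using fun h : 0 < q s => h.ne'
  have h2 := hac h1
  rw [densityMeasure, withDensity_apply_eq_zero hp.ennreal_ofReal] at h2
  rw [ae_iff]
  refine measure_mono_null (fun s hs => ?_) h2
  simp only [Set.mem_ofPred_eq, Classical.not_imp] at hs
  simp only [Set.mem_inter_iff, Set.mem_ofPred_eq, ne_eq, ENNReal.ofReal_eq_zero, not_le]
  exact ⟨lt_of_le_of_ne (hp0 s) (Ne.symm hs.2), hs.1⟩

/-- Under absolute continuity the Radon-Nikodym derivative is `p / q`; where `q = 0` also `p = 0`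
almost everywhere, so the division there does no damage. -/
lemma klDiv_densityMeasure [SigmaFinite lam] (hp : Measurable p) (hq : Measurable q)
    (hp0 : ∀ s, 0 ≤ p s) (hq0 : ∀ s, 0 ≤ q s) [IsProbabilityMeasure (densityMeasure lam p)]
    [IsProbabilityMeasure (densityMeasure lam q)]
    (hac : densityMeasure lam p ≪ densityMeasure lam q) :
    InformationTheory.klDiv (densityMeasure lam p) (densityMeasure lam q)
      = ∫⁻ s, ENNReal.ofReal (q s * InformationTheory.klFun (p s / q s)) ∂lam := by
  have hr : Measurable fun s => ENNReal.ofReal (p s / q s) := (hp.div hq).ennreal_ofReal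
  have h1 : densityMeasure lam p
      = (densityMeasure lam q).withDensity fun s => ENNReal.ofReal (p s / q s) := by
    rw [densityMeasure, densityMeasure, ← withDensity_mul _ hq.ennreal_ofReal hr]
    refine withDensity_congr_ae ?_
    filter_upwards [ae_eq_zero_of_densityMeasure_ac hp hq hp0 hac] with s hs
    rw [Pi.mul_apply, ← ENNReal.ofReal_mul (hq0 s)]
    by_cases h : q s = 0
    · simp [h, hs h]
    · rw [mul_div_cancel₀ _ h]
  have h2 : (densityMeasure lam p).rnDeriv (densityMeasure lam q)
      =ᵐ[densityMeasure lam q] fun s => ENNReal.ofReal (p s / q s) := by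
    conv_lhs => rw [h1]
    exact Measure.rnDeriv_withDensity _ hr
  rw [InformationTheory.klDiv_eq_lintegral_klFun_of_ac hac]
  have h3 : ∫⁻ s, ENNReal.ofReal (InformationTheory.klFun
        (((densityMeasure lam p).rnDeriv (densityMeasure lam q) s).toReal)) ∂densityMeasure lam q
      = ∫⁻ s, ENNReal.ofReal (InformationTheory.klFun (p s / q s)) ∂densityMeasure lam q := by
    refine lintegral_congr_ae (h2.mono fun s hs => ?_)
    simp only [hs, ENNReal.toReal_ofReal (div_nonneg (hp0 s) (hq0 s))]
  have hk : Measurable fun s => ENNReal.ofReal (InformationTheory.klFun (p s / q s)) :=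
    (InformationTheory.measurable_klFun.comp (hp.div hq)).ennreal_ofReal
  rw [h3, densityMeasure, lintegral_withDensity_eq_lintegral_mul _ hq.ennreal_ofReal hk]
  refine lintegral_congr fun s => ?_
  rw [Pi.mul_apply, ← ENNReal.ofReal_mul (hq0 s)]

end density

/-! ### Known densities -/

namespace KnownDensityModel

variable {n : ℕ} {S : Type*} [MeasurableSpace S] {lam : Measure S} {supp : Rn n → Set S}
  {p : Rn n → S → ℝ} {pt : S → ℝ} {F : Rn n → S → ℝ} {Lξ M Lf Mf : ℝ≥0}

lemma p_nonneg (h : KnownDensityModel lam supp p pt F Lξ M Lf Mf) (x : Rn n) (s : S) :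
    0 ≤ p x s := by
  by_cases hs : s ∈ supp x
  · exact (h.p_pos x s hs).le
  · exact (h.p_zero x s hs).ge

lemma p_le (h : KnownDensityModel lam supp p pt F Lξ M Lf Mf) (x : Rn n) (s : S) :
    p x s ≤ M * pt s := by
  by_cases hs : s ∈ supp x
  · exact (div_le_iff₀ (h.pt_pos x s hs)).1 (h.ratio_le x s hs)
  · rw [h.p_zero x s hs]
    exact mul_nonneg M.2 (h.pt_nonneg s)

lemma measurable_p_apply (h : KnownDensityModel lam supp p pt F Lξ M Lf Mf) (x : Rn n) :
    Measurable (p x) :=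
  h.measurable_p.comp (measurable_const.prodMk measurable_id)

lemma measurable_F_apply (h : KnownDensityModel lam supp p pt F Lξ M Lf Mf) (x : Rn n) :
    Measurable (F x) :=
  h.measurable_F.comp (measurable_const.prodMk measurable_id)

/-- Where `pt` vanishes, `p x ≤ M pt` forces `p x = 0`, so importance weighting loses no mass. -/
lemma pt_mul_eq (h : KnownDensityModel lam supp p pt F Lξ M Lf Mf) (x : Rn n) (s : S) :
    pt s * (F x s * p x s / pt s) = F x s * p x s := by
  by_cases hs : pt s = 0
  · have h1 := h.p_le x s
    rw [hs, mul_zero] at h1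
    rw [le_antisymm h1 (h.p_nonneg x s), hs]
    simp
  · rw [mul_div_cancel₀ _ hs]

lemma klDiv_ac (h : KnownDensityModel lam supp p pt F Lξ M Lf Mf) (x y : Rn n) :
    densityMeasure lam (p x) ≪ densityMeasure lam (p y) := by
  have h1 : InformationTheory.klDiv (densityMeasure lam (p x)) (densityMeasure lam (p y)) ≠ ∞ :=
    ne_top_of_le_ne_top ENNReal.ofReal_ne_top (le_self_add.trans (h.symm_kl_le x y))
  exact (InformationTheory.klDiv_ne_top_iff.1 h1).1

lemma lintegral_symm_kl_le (h : KnownDensityModel lam supp p pt F Lξ M Lf Mf) (x y : Rn n) :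
    ∫⁻ s, ENNReal.ofReal (p y s * InformationTheory.klFun (p x s / p y s)
      + p x s * InformationTheory.klFun (p y s / p x s)) ∂lam
      ≤ ENNReal.ofReal ((Lξ : ℝ) ^ 2 * ‖x - y‖ ^ 2) := by
  have := h.sigmaFinite
  have := h.p_probability x
  have := h.p_probability y
  have hk : ∀ x y s, 0 ≤ p y s * InformationTheory.klFun (p x s / p y s) := fun x y s =>
    mul_nonneg (h.p_nonneg y s)
      (InformationTheory.klFun_nonneg (div_nonneg (h.p_nonneg x s) (h.p_nonneg y s)))
  have hm : Measurable fun s =>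
      ENNReal.ofReal (p y s * InformationTheory.klFun (p x s / p y s)) :=
    ((h.measurable_p_apply y).mul (InformationTheory.measurable_klFun.comp
      ((h.measurable_p_apply x).div (h.measurable_p_apply y)))).ennreal_ofReal
  refine le_of_eq_of_le ?_ (h.symm_kl_le x y)
  rw [klDiv_densityMeasure (h.measurable_p_apply x) (h.measurable_p_apply y) (h.p_nonneg x)
    (h.p_nonneg y) (h.klDiv_ac x y), klDiv_densityMeasure (h.measurable_p_apply y)
    (h.measurable_p_apply x) (h.p_nonneg y) (h.p_nonneg x) (h.klDiv_ac y x),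
    ← lintegral_add_left hm]
  exact lintegral_congr fun s => ENNReal.ofReal_add (hk x y s) (hk y x s)

lemma integrable_p (h : KnownDensityModel lam supp p pt F Lξ M Lf Mf) (x : Rn n) :
    Integrable (p x) lam := by
  have := h.p_probability x
  refine ⟨(h.measurable_p_apply x).aestronglyMeasurable, ?_⟩
  rw [hasFiniteIntegral_iff_ofReal (ae_of_all _ fun s => h.p_nonneg x s)]
  have h1 := measure_univ (μ := densityMeasure lam (p x))
  rw [densityMeasure, withDensity_apply _ MeasurableSet.univ, Measure.restrict_univ] at h1
  rw [h1]
  exact ENNReal.one_lt_top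

lemma integrable_mul (h : KnownDensityModel lam supp p pt F Lξ M Lf Mf) (x : Rn n) :
    Integrable (fun s => F x s * p x s) lam := by
  refine ((h.integrable_p x).const_mul Mf).mono'
    ((h.measurable_F_apply x).mul (h.measurable_p_apply x)).aestronglyMeasurable ?_
  filter_upwards [h.bounded x] with s hs
  rw [norm_mul, Real.norm_of_nonneg (h.p_nonneg x s), Real.norm_eq_abs]
  by_cases hsupp : s ∈ supp x
  · exact mul_le_mul_of_nonneg_right (hs hsupp) (h.p_nonneg x s)
  · simp [h.p_zero x s hsupp]

/-- Split `u a - v b = (u - v) a + v (a - b)` and use `(r + s)² ≤ 2 r² + 2 s²`. The bound on `v` is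
asked only where `a ≠ b`, since `F` is bounded only on the support. -/
lemma sq_weighted_sub_le {a b t u v Mf' M' K : ℝ} (ht : 0 < t) (ha : 0 ≤ a)
    (hat : a ≤ M' * t) (hbt : b ≤ M' * t) (hv : a - b ≠ 0 → |v| ≤ Mf') (hK0 : 0 ≤ K)
    (hK : (a - b) ^ 2 ≤ max a b * K) :
    t * (u * a / t - v * b / t) ^ 2
      ≤ 2 * M' ^ 2 * (t * (u - v) ^ 2) + 2 * Mf' ^ 2 * M' * K := by
  have h1 : t * (u * a / t - v * b / t) ^ 2 = ((u - v) * a + v * (a - b)) ^ 2 / t := by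
    field_simp
    ring
  rw [h1, div_le_iff₀ ht]
  have h2 : v ^ 2 * (a - b) ^ 2 ≤ Mf' ^ 2 * (M' * t * K) := by
    by_cases hab : a - b = 0
    · rw [hab]
      have : 0 ≤ M' * t := ha.trans hat
      simp only [ne_eq, OfNat.ofNat_ne_zero, not_false_eq_true, zero_pow, mul_zero]
      positivity
    · have h3 : v ^ 2 ≤ Mf' ^ 2 := sq_le_sq' (by linarith [(abs_le.1 (hv hab)).1])
        (abs_le.1 (hv hab)).2
      have h4 : (a - b) ^ 2 ≤ M' * t * K :=
        hK.trans (mul_le_mul_of_nonneg_right (max_le hat hbt) hK0)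
      gcongr
  have h5 : (u - v) ^ 2 * a ^ 2 ≤ (u - v) ^ 2 * (M' * t) ^ 2 := by gcongr
  nlinarith [sq_nonneg ((u - v) * a - v * (a - b))]

lemma lintegral_sub_sq_le (h : KnownDensityModel lam supp p pt F Lξ M Lf Mf) (x y : Rn n) :
    ∫⁻ s, ENNReal.ofReal ((F x s * p x s / pt s - F y s * p y s / pt s) ^ 2)
        ∂densityMeasure lam pt
      ≤ ENNReal.ofReal ((2 * M ^ 2 * Lf ^ 2 + 2 * Mf ^ 2 * M * Lξ ^ 2) * ‖x - y‖ ^ 2) := by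
  have hmF : ∀ x, Measurable fun s => F x s * p x s / pt s := fun x =>
    ((h.measurable_F_apply x).mul (h.measurable_p_apply x)).div h.measurable_pt
  have hpt := h.measurable_pt.ennreal_ofReal
  have hlip := (eLpNorm_two_le_iff _ _ (by positivity)).1 (h.lipschitz x y)
  have hsub : Measurable fun s => ENNReal.ofReal ((F x s - F y s) ^ 2) :=
    (((h.measurable_F_apply x).sub (h.measurable_F_apply y)).pow_const 2).ennreal_ofReal
  rw [densityMeasure, lintegral_withDensity_eq_lintegral_mul _ hpt hsub] at hlip
  have hsubG : Measurable fun s =>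
      ENNReal.ofReal ((F x s * p x s / pt s - F y s * p y s / pt s) ^ 2) :=
    (((hmF x).sub (hmF y)).pow_const 2).ennreal_ofReal
  rw [densityMeasure, lintegral_withDensity_eq_lintegral_mul _ hpt hsubG]
  set K : S → ℝ := fun s => p y s * InformationTheory.klFun (p x s / p y s)
      + p x s * InformationTheory.klFun (p y s / p x s) with hK
  have hK0 : ∀ s, 0 ≤ K s := fun s => add_nonneg
    (mul_nonneg (h.p_nonneg y s)
      (InformationTheory.klFun_nonneg (div_nonneg (h.p_nonneg x s) (h.p_nonneg y s))))
    (mul_nonneg (h.p_nonneg x s)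
      (InformationTheory.klFun_nonneg (div_nonneg (h.p_nonneg y s) (h.p_nonneg x s))))
  calc _ ≤ ∫⁻ s, (ENNReal.ofReal (2 * M ^ 2)
          * (ENNReal.ofReal (pt s) * ENNReal.ofReal ((F x s - F y s) ^ 2))
          + ENNReal.ofReal (2 * Mf ^ 2 * M) * ENNReal.ofReal (K s)) ∂lam := by
        refine lintegral_mono_ae ?_
        filter_upwards [h.bounded y, ae_eq_zero_of_densityMeasure_ac (h.measurable_p_apply x)
          (h.measurable_p_apply y) (h.p_nonneg x) (h.klDiv_ac x y)] with s hb hz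
        have hpts := h.pt_nonneg s
        have hKs := hK0 s
        rw [Pi.mul_apply, ← ENNReal.ofReal_mul hpts, ← ENNReal.ofReal_mul hpts,
          ← ENNReal.ofReal_mul (by positivity), ← ENNReal.ofReal_mul (by positivity),
          ← ENNReal.ofReal_add (by positivity) (by positivity)]
        refine ENNReal.ofReal_le_ofReal ?_
        rcases hpts.eq_or_lt with h0 | hpos
        · rw [← h0]
          simp only [zero_mul, mul_zero, zero_add]
          positivity
        · refine sq_weighted_sub_le hpos (h.p_nonneg x s) (h.p_le x s) (h.p_le y s)
            (fun hne => hb ?_) hKs (sq_sub_le_max_mul_klFun (h.p_nonneg x s) (h.p_nonneg y s))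
          -- Off `supp y` the density `p y` vanishes, hence so does `p x` almost everywhere by
          -- absolute continuity, contradicting `p x s ≠ p y s`.
          by_contra hs
          have h1 := h.p_zero y s hs
          rw [h1, hz h1] at hne
          simp at hne
    _ ≤ ENNReal.ofReal (2 * M ^ 2) * ENNReal.ofReal ((Lf * ‖x - y‖) ^ 2)
          + ENNReal.ofReal (2 * Mf ^ 2 * M) * ENNReal.ofReal ((Lξ : ℝ) ^ 2 * ‖x - y‖ ^ 2) := by
        have hmul : Measurable fun s => ENNReal.ofReal (2 * (M : ℝ) ^ 2)
            * (ENNReal.ofReal (pt s) * ENNReal.ofReal ((F x s - F y s) ^ 2)) :=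
          (hpt.mul hsub).const_mul _
        rw [lintegral_add_left hmul,
          lintegral_const_mul' _ _ ENNReal.ofReal_ne_top,
          lintegral_const_mul' _ _ ENNReal.ofReal_ne_top]
        gcongr
        · exact hlip
        · exact h.lintegral_symm_kl_le x y
    _ = _ := by
        rw [← ENNReal.ofReal_mul (by positivity), ← ENNReal.ofReal_mul (by positivity),
          ← ENNReal.ofReal_add (by positivity) (by positivity)]
        congr 1
        ring

lemma standardModel (h : KnownDensityModel lam supp p pt F Lξ M Lf Mf) :
    StandardModel (densityMeasure lam pt) (fun y s => F y s * p y s / pt s)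
      (NNReal.sqrt (2 * M ^ 2 * Lf ^ 2 + 2 * Mf ^ 2 * M * Lξ ^ 2)) where
  isProbability := h.pt_probability
  measurable := (h.measurable_F.mul h.measurable_p).div (h.measurable_pt.comp measurable_snd)
  integrable x := by
    rw [densityMeasure, integrable_withDensity_iff_integrable_smul₀'
      h.measurable_pt.ennreal_ofReal.aemeasurable (ae_of_all _ fun s => ENNReal.ofReal_lt_top)]
    refine (h.integrable_mul x).congr (ae_of_all _ fun s => ?_)
    simp only [ENNReal.toReal_ofReal (h.pt_nonneg s), smul_eq_mul, h.pt_mul_eq]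
  lipschitz x y := by
    refine (eLpNorm_two_le_iff _ _ (by positivity)).2 ((h.lintegral_sub_sq_le x y).trans_eq ?_)
    rw [mul_pow, Real.coe_sqrt, Real.sq_sqrt (NNReal.coe_nonneg _)]
    push_cast
    rfl

lemma integral_eq (h : KnownDensityModel lam supp p pt F Lξ M Lf Mf) (y : Rn n) :
    ∫ s in supp y, F y s * p y s ∂lam = ∫ s, F y s * p y s / pt s ∂densityMeasure lam pt := by
  rw [densityMeasure, integral_withDensity_eq_integral_toReal_smul
    h.measurable_pt.ennreal_ofReal (ae_of_all _ fun s => ENNReal.ofReal_lt_top)]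
  simp only [ENNReal.toReal_ofReal (h.pt_nonneg _), smul_eq_mul, h.pt_mul_eq]
  refine setIntegral_eq_integral_of_forall_compl_eq_zero fun s hs => ?_
  rw [h.p_zero y s hs, mul_zero]

end KnownDensityModel

end

theorem proposition5p6 {n : ℕ} {Ω S E : Type*} [MeasurableSpace Ω] [MeasurableSpace S]
    [MeasurableSpace E] (P : Measure Ω) [IsProbabilityMeasure P]
    (x₀ : Rn n) (γ η : ℕ → ℝ) (hγη : IsStepChoice γ η)
    (V : ℕ → Ω → ℝ) (Z : ℕ → Ω → Rn n) (ξ : ℕ → Ω → S) (x : ℕ → Ω → Rn n)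
    (hx : HasASConvergentSubsubsequences P x) :
    -- decision-independent setting
    (∀ (ν : Measure S) (F : Rn n → S → ℝ) (L₀ : ℝ≥0),
      StandardModel ν F L₀ → IsSampling P η ν V Z ξ →
      IsIteration x₀ γ η (fun k ω y => F y (ξ k ω)) V Z x →
      HasStationaryClusterPoint P x (fun y => ∫ s, F y s ∂ν)) ∧
    -- decision-dependent setting, known densities
    (∀ (lam : Measure S) (supp : Rn n → Set S) (p : Rn n → S → ℝ) (pt : S → ℝ)
      (F : Rn n → S → ℝ) (Lξ M Lf Mf : ℝ≥0),
      KnownDensityModel lam supp p pt F Lξ M Lf Mf →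
      IsSampling P η (densityMeasure lam pt) V Z ξ →
      IsIteration x₀ γ η (fun k ω y => F y (ξ k ω) * p y (ξ k ω) / pt (ξ k ω)) V Z x →
      HasStationaryClusterPoint P x (fun y => ∫ s in supp y, F y s * p y s ∂lam)) ∧
    -- decision-dependent setting, unknown densities
    (∀ (ν : Measure S) (field : Rn n → S → E) (D : Rn n → Measure E)
      (F : Rn n → E → ℝ) (L₀ : ℝ≥0),
      RandomFieldModel ν field D F L₀ → IsSampling P η ν V Z ξ →
      IsIteration x₀ γ η (fun k ω y => F y (field y (ξ k ω))) V Z x →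
      HasStationaryClusterPoint P x (fun y => ∫ e, F y e ∂(D y))) := by
  refine ⟨fun ν F L₀ h hs hi => h.hasStationaryClusterPoint hγη hx hs hi,
    fun lam supp p pt F Lξ M Lf Mf h hs hi => ?_, fun ν field D F L₀ h hs hi => ?_⟩
  · rw [funext h.integral_eq]
    exact h.standardModel.hasStationaryClusterPoint hγη hx hs hi
  · rw [funext h.integral_eq]
    exact h.standardModel.hasStationaryClusterPoint hγη hx hs hi
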